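/- Let $\mu$ be a Borel probability measure on $\mathbb{C}$ with $\int \log^+|z|\,\mathrm{d}\mu(z)<\infty$, and let $U^\mu\colon\mathbb{C}\to\mathbb{R}\cup\{+\infty\}$, $U^\mu(z)=\int -\log|w-z|\,\mathrm{d}\mu(w)$, be its potential. Then the following are equivalent: 1. $U^\mu(z)\le 0$ for every $z\in\mathbb{C}$; 2. there is a sequence $(K_n)$ of compact subsets of $\mathbb{C}$ of capacity one whose equilibrium measures $\mu_{K_n}$ converge log-weakly to $\mu$, that is, $\int f\,\mathrm{d}\mu_{K_n}\to\int f\,\mathrm{d}\mu$ for every continuous $f\colon\mathbb{C}\to\mathbb{R}$ for which there are constants $A,B$ with $|f(z)|\le A+B\log^+|z|$ for all $z\in\mathbb{C}$. Here, the energy of a probability measure $\nu$ is $I(\nu)=\int U^\nu\,\mathrm{d}\nu$. A compact set $K$ is polar if every Borel probability measure supported on $K$ has energy $+\infty$; if $K$ is not polar, its equilibrium measure $\mu_K$ is the (unique) probability measure of least energy among those supported on $K$, and the capacity of $K$ is $\operatorname{cap}(K)=e^{-I(\mu_K)}$ (and $0$ if $K$ is polar). -/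

import Mathlib

open MeasureTheory Filter Topology

/-- The space `𝒫_log(ℂ)`: Borel probability measures on `ℂ` which integrate `log⁺ |z|`. -/
def MemPLog (μ : Measure ℂ) : Prop :=
  IsProbabilityMeasure μ ∧ Integrable (fun z : ℂ => Real.posLog ‖z‖) μ

/-- A function `f : ℂ → ℝ` has logarithmic growth if `|f z| ≤ A + B log⁺ |z|` for constants
`A`, `B`. -/
def HasLogGrowth (f : ℂ → ℝ) : Prop :=
  ∃ A B : ℝ, ∀ z : ℂ, |f z| ≤ A + B * Real.posLog ‖z‖

/-- The sequence `ν n` of elements of `𝒫_log(ℂ)` converges log-weakly to `μ ∈ 𝒫_log(ℂ)`. -/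
def LogWeakTendsto (ν : ℕ → Measure ℂ) (μ : Measure ℂ) : Prop :=
  (∀ n, MemPLog (ν n)) ∧ MemPLog μ ∧
    ∀ f : ℂ → ℝ, Continuous f → HasLogGrowth f →
      Tendsto (fun n => ∫ z, f z ∂(ν n)) atTop (𝓝 (∫ z, f z ∂μ))

/-- The integral of an extended-real-valued function, as the difference of the integrals of its
positive and negative parts. It is the usual one as soon as one of these is finite. -/
noncomputable def erealIntegral (μ : Measure ℂ) (f : ℂ → EReal) : EReal :=
  ((∫⁻ z, (f z).toENNReal ∂μ : ENNReal) : EReal) - ((∫⁻ z, (-f z).toENNReal ∂μ : ENNReal) : EReal)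

/-- The logarithmic kernel `-log |w - z|`, with the value `+∞` for `w = z`. -/
noncomputable def logKernel (z w : ℂ) : EReal := -ENNReal.log ‖w - z‖ₑ

/-- The potential `U^μ(z) = ∫ -log |w - z| dμ(w)`. -/
noncomputable def logPotential (μ : Measure ℂ) (z : ℂ) : EReal :=
  erealIntegral μ (logKernel z)

/-- The energy `I(μ) = ∫ U^μ dμ`. -/
noncomputable def logEnergy (μ : Measure ℂ) : EReal :=
  erealIntegral μ (logPotential μ)

/-- The set `𝒫(K)` of Borel probability measures supported on `K`. -/
def probMeasuresOn (K : Set ℂ) : Set (Measure ℂ) :=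
  {ν | IsProbabilityMeasure ν ∧ ν Kᶜ = 0}

/-- `K` is polar if every probability measure on `K` has energy `+∞`. -/
def IsPolarSet (K : Set ℂ) : Prop :=
  ∀ ν ∈ probMeasuresOn K, logEnergy ν = ⊤

/-- `ν` is the equilibrium measure of the (non-polar, compact) set `K`: the measure in `𝒫(K)` of
least energy. -/
def IsEquilibriumMeasure (K : Set ℂ) (ν : Measure ℂ) : Prop :=
  ¬ IsPolarSet K ∧ ν ∈ probMeasuresOn K ∧ ∀ ν' ∈ probMeasuresOn K, logEnergy ν ≤ logEnergy ν'

/-- The capacity `exp (-inf {I(ν) | ν ∈ 𝒫(K)})` of a compact set; it is `0` if `K` is polar, and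
`exp (-I(ν))` if `ν` is the equilibrium measure of `K`. -/
noncomputable def logCapacity (K : Set ℂ) : ENNReal :=
  EReal.exp (-⨅ ν ∈ probMeasuresOn K, logEnergy ν)

/-!
Write `g_τ(z) = ∫ log |z - w| dτ(w) = -U^τ(z)` (`logIntegral`).

*Limits of equilibrium measures have nonpositive potential.* An equilibrium measure `ν` of a set of
capacity one has energy zero. Mixing `ν` with its restrictions to subsets cannot lower the energy,
so `g_ν = 0` holds `ν`-almost everywhere (`logIntegral_ae_eq_zero`), hence `g_ν ≥ 0` on the support
by semicontinuity, hence everywhere by the maximum principle (`logIntegral_nonneg_of_support`). The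
truncated kernels `log (max r |z - w|)` are continuous test functions of logarithmic growth, so
nonnegativity of their integrals passes to the limit measure, and letting `r → 0` finishes
(`logPotential_nonpos_of_tendsto`).

*Measures with nonpositive potential are limits.* The compact sets are lemniscates
`K = {|P| ≤ 1}` with `P` monic of degree `N`. The pull-back `ω` under `P` of the uniform measure on
the unit circle, divided by `N`, satisfies `g_ω = N⁻¹ log⁺ |P|` by Jensen's formula
(`logIntegral_lemniscateMeasure`); in particular its energy is zero. No measure on `K` has negative
energy, by an estimate of Vandermonde determinants (`logEnergy_nonneg_of_lemniscate`), so `K` has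
capacity one and `ω` is its equilibrium measure.

For `P = ∏ (X - x_i)` with independent points `x_i` of law `μ`, the law of large numbers gives
`N⁻¹ log |P| → g_μ` in `L¹` on discs and on the unit circle. Since `g_μ ≥ 0`, taking positive parts gives
`g_ω = N⁻¹ log⁺ |P| → g_μ` in the same sense (`exists_lemniscateMeasure_near`): the roots need not
be separated in any way. Convergence of potentials implies log-weak convergence of measures
(`logWeakTendsto_of_logIntegral`), because averages of `g_τ` over circles are integrals against `τ`
of explicit functions, among them `log⁺ |w|` and bumps that can serve as mollifiers.
-/

/-! ### Extended-real integrals of the logarithmic kernel -/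

theorem logKernel_of_ne {z w : ℂ} (h : w ≠ z) :
    logKernel z w = ((-Real.log ‖z - w‖ : ℝ) : EReal) := by
  have h0 : 0 < ‖w - z‖ := norm_pos_iff.2 (sub_ne_zero.2 h)
  rw [logKernel, ← ofReal_norm, ENNReal.log_ofReal_of_pos h0, norm_sub_rev, EReal.coe_neg]

theorem logKernel_self (z : ℂ) : logKernel z z = ⊤ := by
  simp [logKernel]

theorem measurable_log_norm_sub :
    Measurable (fun p : ℂ × ℂ => Real.log ‖p.1 - p.2‖) := by fun_prop

theorem measurable_log_norm_const_sub (z : ℂ) : Measurable (fun w : ℂ => Real.log ‖z - w‖) :=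
  measurable_log_norm_sub.comp measurable_prodMk_left

theorem erealIntegral_eq_coe {μ : Measure ℂ} {F : ℂ → EReal} {f : ℂ → ℝ}
    (hF : ∀ᵐ z ∂μ, F z = (f z : EReal)) (hf : Integrable f μ) :
    erealIntegral μ F = ((∫ z, f z ∂μ : ℝ) : EReal) := by
  have h1 : ∫⁻ z, (F z).toENNReal ∂μ = ∫⁻ z, ENNReal.ofReal (f z) ∂μ :=
    lintegral_congr_ae (hF.mono fun z hz => by simp [hz])
  have h2 : ∫⁻ z, (-F z).toENNReal ∂μ = ∫⁻ z, ENNReal.ofReal (-f z) ∂μ :=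
    lintegral_congr_ae (hF.mono fun z hz => by
      simp only [hz]; rw [← EReal.coe_neg, EReal.real_coe_toENNReal])
  have f1 : ∫⁻ z, ENNReal.ofReal (f z) ∂μ ≠ ⊤ := (hf.lintegral_lt_top).ne
  have f2 : ∫⁻ z, ENNReal.ofReal (-f z) ∂μ ≠ ⊤ := (hf.neg.lintegral_lt_top).ne
  rw [erealIntegral, h1, h2, integral_eq_lintegral_pos_part_sub_lintegral_neg_part hf,
    EReal.coe_sub, EReal.coe_ennreal_toReal f1, EReal.coe_ennreal_toReal f2]

theorem logPotential_eq_coe {τ : Measure ℂ} {z : ℂ}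
    (hi : Integrable (fun w => Real.log ‖z - w‖) τ) (hz : τ {z} = 0) :
    logPotential τ z = ((-∫ w, Real.log ‖z - w‖ ∂τ : ℝ) : EReal) := by
  rw [← integral_neg]
  refine erealIntegral_eq_coe ?_ hi.neg
  have : ∀ᵐ w ∂τ, w ≠ z := by simpa [ae_iff] using hz
  exact this.mono fun w hw => logKernel_of_ne hw

/-- The positive part of the logarithmic kernel, as an extended nonnegative real. -/
noncomputable def logKernelPos (z w : ℂ) : ENNReal := (logKernel z w).toENNReal

theorem measurable_logKernelPos : Measurable (fun p : ℂ × ℂ => logKernelPos p.1 p.2) := by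
  unfold logKernelPos logKernel
  fun_prop

theorem toENNReal_neg_logKernel_le (z w : ℂ) :
    (-logKernel z w).toENNReal ≤ ENNReal.ofReal (Real.posLog ‖z - w‖) := by
  by_cases h : w = z
  · subst h; simp [logKernel_self]
  · rw [logKernel_of_ne h, ← EReal.coe_neg, EReal.real_coe_toENNReal, neg_neg]
    exact ENNReal.ofReal_le_ofReal (le_max_right _ _)

/-- On the diagonal the left-hand side vanishes, since `Real.log 0 = 0`, while the right-hand side
is infinite. -/
theorem enorm_log_le (z w : ℂ) :
    ‖Real.log ‖z - w‖‖ₑ ≤ logKernelPos z w + ENNReal.ofReal (Real.posLog ‖z - w‖) := by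
  by_cases h : w = z
  · subst h; simp
  · rw [logKernelPos, logKernel_of_ne h, EReal.real_coe_toENNReal, Real.enorm_eq_ofReal_abs]
    rcases le_total 0 (Real.log ‖z - w‖) with h0 | h0
    · rw [abs_of_nonneg h0]
      exact le_add_left (ENNReal.ofReal_le_ofReal (le_max_right _ _))
    · rw [abs_of_nonpos h0]
      exact le_add_right le_rfl

theorem posLog_norm_sub_le (z w : ℂ) :
    Real.posLog ‖z - w‖ ≤ Real.log 2 + Real.posLog ‖z‖ + Real.posLog ‖w‖ := by
  have := Real.posLog_norm_add_le z (-w)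
  rw [← sub_eq_add_neg, norm_neg] at this
  linarith

theorem integrable_posLog_norm_sub {τ : Measure ℂ} [IsFiniteMeasure τ]
    (hτ : Integrable (fun w : ℂ => Real.posLog ‖w‖) τ) (z : ℂ) :
    Integrable (fun w : ℂ => Real.posLog ‖z - w‖) τ := by
  refine ((integrable_const (Real.log 2 + Real.posLog ‖z‖)).add hτ).mono'
    (by fun_prop) (ae_of_all _ fun w => ?_)
  rw [Real.norm_of_nonneg Real.posLog_nonneg]
  exact posLog_norm_sub_le z w

theorem lintegral_neg_logKernel_lt_top {τ : Measure ℂ} [IsFiniteMeasure τ]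
    (hτ : Integrable (fun w : ℂ => Real.posLog ‖w‖) τ) (z : ℂ) :
    ∫⁻ w, (-logKernel z w).toENNReal ∂τ < ⊤ :=
  (lintegral_mono fun w => toENNReal_neg_logKernel_le z w).trans_lt
    (integrable_posLog_norm_sub hτ z).lintegral_lt_top

theorem integrable_log_of_lintegral_logKernelPos {τ : Measure ℂ} [IsFiniteMeasure τ]
    (hτ : Integrable (fun w : ℂ => Real.posLog ‖w‖) τ) {z : ℂ}
    (h : ∫⁻ w, logKernelPos z w ∂τ ≠ ⊤) :
    Integrable (fun w => Real.log ‖z - w‖) τ ∧ τ {z} = 0 := by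
  constructor
  · refine ⟨(measurable_log_norm_const_sub z).aestronglyMeasurable, ?_⟩
    refine (lintegral_mono fun w => enorm_log_le z w).trans_lt ?_
    have hm : Measurable fun w : ℂ => ENNReal.ofReal (Real.posLog ‖z - w‖) := by fun_prop
    rw [lintegral_add_right _ hm]
    exact ENNReal.add_lt_top.2 ⟨h.lt_top, (integrable_posLog_norm_sub hτ z).lintegral_lt_top⟩
  · have hm : Measurable fun w => logKernelPos z w := by
      unfold logKernelPos logKernel
      fun_prop
    have : ∀ᵐ w ∂τ, w ≠ z := by
      filter_upwards [ae_lt_top hm h] with w hw hwz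
      rw [hwz, logKernelPos, logKernel_self] at hw
      exact absurd hw (by simp)
    simpa [ae_iff] using this

/-- The logarithmic growth of `τ` controls the negative part of the kernel, so finiteness of the
potential at `z` alone gives integrability. -/
theorem integrable_log_of_logPotential_ne_top {τ : Measure ℂ} [IsFiniteMeasure τ]
    (hτ : Integrable (fun w : ℂ => Real.posLog ‖w‖) τ) {z : ℂ} (h : logPotential τ z ≠ ⊤) :
    Integrable (fun w => Real.log ‖z - w‖) τ ∧ τ {z} = 0 := by
  refine integrable_log_of_lintegral_logKernelPos hτ fun hT => h ?_
  have hb := (lintegral_neg_logKernel_lt_top hτ z).ne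
  unfold logKernelPos at hT
  rw [logPotential, erealIntegral, hT, EReal.coe_ennreal_top]
  exact EReal.top_sub (by simpa using hb)
  
/-! ### Energies of measures on bounded sets -/

theorem integrable_posLog_of_bounded {K : Set ℂ} (hK : Bornology.IsBounded K) {τ : Measure ℂ}
    (hτ : τ ∈ probMeasuresOn K) : Integrable (fun w : ℂ => Real.posLog ‖w‖) τ := by
  have := hτ.1
  obtain ⟨R, hR⟩ := hK.exists_norm_le
  have hae : ∀ᵐ w ∂τ, w ∈ K := hτ.2
  refine (integrable_const (Real.posLog R)).mono' (by fun_prop) (hae.mono fun w hw => ?_)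
  rw [Real.norm_of_nonneg Real.posLog_nonneg]
  exact Real.posLog_le_posLog (norm_nonneg _) (hR w hw)

theorem memPLog_of_bounded {K : Set ℂ} (hK : Bornology.IsBounded K) {τ : Measure ℂ}
    (hτ : τ ∈ probMeasuresOn K) : MemPLog τ := ⟨hτ.1, integrable_posLog_of_bounded hK hτ⟩

/-- The energy as a genuine integral of the kernel against the product measure. -/
theorem logEnergy_eq_coe {τ : Measure ℂ} [IsFiniteMeasure τ]
    (hi : Integrable (fun p : ℂ × ℂ => Real.log ‖p.1 - p.2‖) (τ.prod τ))
    (hd : ∀ᵐ z ∂τ, τ {z} = 0) :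
    logEnergy τ = ((-∫ p, Real.log ‖p.1 - p.2‖ ∂(τ.prod τ) : ℝ) : EReal) := by
  rw [integral_prod _ hi, ← integral_neg]
  refine erealIntegral_eq_coe ?_ hi.integral_prod_left.neg
  filter_upwards [hd, hi.prod_right_ae] with z h1 h2
  exact logPotential_eq_coe h2 h1

/-- Conversely, on a bounded set the kernel is bounded below, so finite energy makes the kernel
integrable for the product measure and excludes atoms. -/
theorem integrable_log_prod_of_logEnergy_ne_top {K : Set ℂ} (hK : Bornology.IsBounded K)
    {τ : Measure ℂ} (hτ : τ ∈ probMeasuresOn K) (h : logEnergy τ ≠ ⊤) :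
    Integrable (fun p : ℂ × ℂ => Real.log ‖p.1 - p.2‖) (τ.prod τ) ∧ ∀ᵐ z ∂τ, τ {z} = 0 := by
  have := hτ.1
  have hp := integrable_posLog_of_bounded hK hτ
  obtain ⟨R, hR⟩ := hK.exists_norm_le
  have hae : ∀ᵐ w ∂τ, w ∈ K := hτ.2
  set C : ℝ := Real.log 2 + Real.posLog R + Real.posLog R with hC
  have hb : ∀ z ∈ K, ∫⁻ w, (-logKernel z w).toENNReal ∂τ ≤ ENNReal.ofReal C := by
    intro z hz
    calc ∫⁻ w, (-logKernel z w).toENNReal ∂τ ≤ ∫⁻ w, ENNReal.ofReal C ∂τ := by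
          refine lintegral_mono_ae (hae.mono fun w hw => (toENNReal_neg_logKernel_le z w).trans ?_)
          refine ENNReal.ofReal_le_ofReal ((posLog_norm_sub_le z w).trans ?_)
          have h1 := Real.posLog_le_posLog (norm_nonneg _) (hR w hw)
          have h2 := Real.posLog_le_posLog (norm_nonneg _) (hR z hz)
          linarith
      _ = ENNReal.ofReal C := by simp
  -- the negative part of the potential is bounded on `K`
  have hneg : ∫⁻ z, (-logPotential τ z).toENNReal ∂τ ≠ ⊤ := by
    refine ne_top_of_le_ne_top (b := ENNReal.ofReal C) ENNReal.ofReal_ne_top ?_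
    calc ∫⁻ z, (-logPotential τ z).toENNReal ∂τ ≤ ∫⁻ w, ENNReal.ofReal C ∂τ := by
          refine lintegral_mono_ae (hae.mono fun z hz => le_trans ?_ (hb z hz))
          have hbt := ne_top_of_le_ne_top ENNReal.ofReal_ne_top (hb z hz)
          rw [logPotential, erealIntegral, EReal.neg_sub (Or.inl (by simp))
            (Or.inr (by simpa using hbt)), add_comm, ← sub_eq_add_neg,
            EReal.toENNReal_sub (EReal.coe_ennreal_nonneg _)]
          simp
      _ = ENNReal.ofReal C := by simp
  have hpos : ∫⁻ z, (logPotential τ z).toENNReal ∂τ ≠ ⊤ := by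
    intro hT
    refine h ?_
    rw [logEnergy, erealIntegral, hT, EReal.coe_ennreal_top]
    exact EReal.top_sub (by simpa using hneg)
  have hle : ∫⁻ z, ∫⁻ w, logKernelPos z w ∂τ ∂τ ≠ ⊤ := by
    refine ne_top_of_le_ne_top (b := ∫⁻ z, (logPotential τ z).toENNReal ∂τ + ENNReal.ofReal C)
      (by finiteness) ?_
    calc ∫⁻ z, ∫⁻ w, logKernelPos z w ∂τ ∂τ
        ≤ ∫⁻ z, ((logPotential τ z).toENNReal + ENNReal.ofReal C) ∂τ := by
          refine lintegral_mono_ae (hae.mono fun z hz => ?_)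
          rw [logPotential, erealIntegral, EReal.toENNReal_sub (EReal.coe_ennreal_nonneg _),
            EReal.toENNReal_coe, EReal.toENNReal_coe]
          exact le_tsub_add.trans (add_le_add_right (hb z hz) _)
      _ = _ := by rw [lintegral_add_right _ measurable_const]; simp
  have hm : Measurable (fun z => ∫⁻ w, logKernelPos z w ∂τ) :=
    measurable_logKernelPos.lintegral_prod_right'
  have haet := ae_lt_top hm hle
  refine ⟨⟨measurable_log_norm_sub.aestronglyMeasurable, ?_⟩, haet.mono fun z hz =>
    (integrable_log_of_lintegral_logKernelPos hp hz.ne).2⟩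
  unfold HasFiniteIntegral
  rw [lintegral_prod _ (by fun_prop)]
  calc ∫⁻ z, ∫⁻ w, ‖Real.log ‖z - w‖‖ₑ ∂τ ∂τ
      ≤ ∫⁻ z, (∫⁻ w, logKernelPos z w ∂τ + ENNReal.ofReal C) ∂τ := by
        refine lintegral_mono_ae (hae.mono fun z hz => ?_)
        calc _ ≤ ∫⁻ w, (logKernelPos z w + ENNReal.ofReal C) ∂τ := by
              refine lintegral_mono_ae (hae.mono fun w hw => (enorm_log_le z w).trans ?_)
              gcongr
              refine (posLog_norm_sub_le z w).trans ?_
              have h1 := Real.posLog_le_posLog (norm_nonneg _) (hR w hw)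
              have h2 := Real.posLog_le_posLog (norm_nonneg _) (hR z hz)
              linarith
          _ = _ := by rw [lintegral_add_right _ measurable_const]; simp
    _ = ∫⁻ z, ∫⁻ w, logKernelPos z w ∂τ ∂τ + ENNReal.ofReal C := by
        rw [lintegral_add_right _ measurable_const]; simp
    _ < ⊤ := by finiteness

/-! ### Uniform measures on circles -/

/-- The uniform probability measure on the circle with centre `c` and radius `r`. -/
noncomputable def circleMeasure (c : ℂ) (r : ℝ) : Measure ℂ :=
  ((ENNReal.ofReal (2 * Real.pi))⁻¹ • volume.restrict (Set.Ioc 0 (2 * Real.pi))).map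
    (circleMap c r)

/-- `z ↦ ∫ log |z - w| dτ(w)`, which is `-U^τ(z)` wherever the integral converges. -/
noncomputable def logIntegral (τ : Measure ℂ) (z : ℂ) : ℝ := ∫ w, Real.log ‖z - w‖ ∂τ

theorem measurable_circleMap' (c : ℂ) (r : ℝ) : Measurable (circleMap c r) :=
  (continuous_circleMap c r).measurable

instance isProbabilityMeasure_circleMeasure (c : ℂ) (r : ℝ) :
    IsProbabilityMeasure (circleMeasure c r) := by
  refine ⟨?_⟩
  rw [circleMeasure, Measure.map_apply (measurable_circleMap' c r) MeasurableSet.univ]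
  have h : ENNReal.ofReal (2 * Real.pi) ≠ 0 := by simp [Real.pi_pos]
  simp [-ENNReal.ofReal_mul]
  exact ENNReal.inv_mul_cancel h ENNReal.ofReal_ne_top

theorem integral_circleMeasure {f : ℂ → ℝ} (hf : Measurable f) (c : ℂ) (r : ℝ) :
    ∫ z, f z ∂(circleMeasure c r) = Real.circleAverage f c r := by
  rw [circleMeasure, integral_map (measurable_circleMap' c r).aemeasurable
    hf.aestronglyMeasurable, integral_smul_measure, Real.circleAverage,
    intervalIntegral.integral_of_le Real.two_pi_pos.le, ENNReal.toReal_inv,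
    ENNReal.toReal_ofReal Real.two_pi_pos.le]

theorem integrable_circleMeasure {f : ℂ → ℝ} (hf : Measurable f) {c : ℂ} {r : ℝ}
    (h : CircleIntegrable f c r) : Integrable f (circleMeasure c r) := by
  rw [circleMeasure, integrable_map_measure hf.aestronglyMeasurable
    (measurable_circleMap' c r).aemeasurable]
  refine Integrable.smul_measure ?_ (by simp [Real.pi_pos])
  exact (intervalIntegrable_iff_integrableOn_Ioc_of_le Real.two_pi_pos.le).1 h

theorem ae_circleMeasure_mem_sphere (c : ℂ) {r : ℝ} (hr : 0 ≤ r) :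
    ∀ᵐ z ∂(circleMeasure c r), ‖z - c‖ = r := by
  rw [circleMeasure, ae_map_iff (measurable_circleMap' c r).aemeasurable
    (measurableSet_eq_fun (by fun_prop) (by fun_prop))]
  refine ae_of_all _ fun θ => ?_
  simp [circleMap_sub_center, abs_of_nonneg hr]

theorem measurable_log_norm_sub_const (w : ℂ) : Measurable (fun z : ℂ => Real.log ‖z - w‖) := by
  have := measurable_log_norm_const_sub w
  simpa only [norm_sub_rev] using this

theorem integrable_log_circleMeasure (c : ℂ) (r : ℝ) (w : ℂ) :
    Integrable (fun z => Real.log ‖z - w‖) (circleMeasure c r) :=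
  integrable_circleMeasure (measurable_log_norm_sub_const w)
    (circleIntegrable_log_norm_sub_const r)

/-- Jensen's formula for a linear factor. -/
theorem integral_log_circleMeasure (c : ℂ) {r : ℝ} (hr : 0 < r) (w : ℂ) :
    ∫ z, Real.log ‖z - w‖ ∂(circleMeasure c r) = Real.log (max r ‖c - w‖) := by
  rw [integral_circleMeasure (measurable_log_norm_sub_const w),
    circleAverage_log_norm_sub_const_eq_log_radius_add_posLog hr.ne',
    Real.posLog_eq_log_max_one (by positivity), ← Real.log_mul hr.ne' (by positivity),
    mul_max_of_nonneg _ _ hr.le, mul_one, mul_inv_cancel_left₀ hr.ne']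

theorem abs_log_eq (x : ℝ) : |Real.log x| = 2 * Real.posLog x - Real.log x := by
  rw [Real.posLog_apply]
  rcases le_total 0 (Real.log x) with h | h
  · rw [abs_of_nonneg h, max_eq_right h]; ring
  · rw [abs_of_nonpos h, max_eq_left h]; ring

theorem integrable_log_circleMeasure_prod {τ : Measure ℂ} [IsFiniteMeasure τ]
    (hτ : Integrable (fun w : ℂ => Real.posLog ‖w‖) τ) (c : ℂ) {r : ℝ} (hr : 0 < r) :
    Integrable (fun p : ℂ × ℂ => Real.log ‖p.1 - p.2‖) ((circleMeasure c r).prod τ) := by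
  rw [integrable_prod_iff' measurable_log_norm_sub.aestronglyMeasurable]
  refine ⟨ae_of_all _ fun w => integrable_log_circleMeasure c r w, ?_⟩
  set C : ℝ := 2 * (Real.log 2 + Real.posLog (‖c‖ + r)) - Real.log r with hC
  have hm : StronglyMeasurable fun w : ℂ => ∫ z, ‖Real.log ‖z - w‖‖ ∂(circleMeasure c r) := by
    refine StronglyMeasurable.integral_prod_left' (f := fun (p : ℂ × ℂ) => ‖Real.log ‖p.1 - p.2‖‖) ?_
    exact (measurable_log_norm_sub.norm).stronglyMeasurable
  refine ((integrable_const C).add (hτ.const_mul 2)).mono' hm.aestronglyMeasurable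
    (ae_of_all _ fun w => ?_)
  rw [Real.norm_of_nonneg (integral_nonneg fun _ => norm_nonneg _)]
  have hb : ∀ᵐ z ∂(circleMeasure c r), Real.posLog ‖z - w‖ ≤
      Real.log 2 + Real.posLog (‖c‖ + r) + Real.posLog ‖w‖ := by
    filter_upwards [ae_circleMeasure_mem_sphere c hr.le] with z hz
    refine (posLog_norm_sub_le z w).trans ?_
    gcongr
    calc ‖z‖ = ‖c + (z - c)‖ := by ring_nf
      _ ≤ ‖c‖ + r := by rw [← hz]; exact norm_add_le _ _
  have hi := integrable_log_circleMeasure c r w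
  calc ∫ z, ‖Real.log ‖z - w‖‖ ∂(circleMeasure c r)
      ≤ ∫ z, (2 * (Real.log 2 + Real.posLog (‖c‖ + r) + Real.posLog ‖w‖) - Real.log ‖z - w‖)
          ∂(circleMeasure c r) := by
        refine integral_mono_ae hi.norm ((integrable_const _).sub hi) ?_
        filter_upwards [hb] with z hz
        simp only [Real.norm_eq_abs, abs_log_eq]
        linarith
    _ = 2 * (Real.log 2 + Real.posLog (‖c‖ + r) + Real.posLog ‖w‖)
          - Real.log (max r ‖c - w‖) := by
        rw [integral_sub (integrable_const _) hi, integral_log_circleMeasure c hr]; simp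
    _ ≤ C + 2 * Real.posLog ‖w‖ := by
        have := Real.log_le_log hr (le_max_left r ‖c - w‖)
        rw [hC]; linarith

theorem measurable_logIntegral (τ : Measure ℂ) [SFinite τ] : Measurable (logIntegral τ) :=
  (StronglyMeasurable.integral_prod_right' (f := fun p : ℂ × ℂ => Real.log ‖p.1 - p.2‖)
    measurable_log_norm_sub.stronglyMeasurable).measurable

theorem integrable_logIntegral_circleMeasure {τ : Measure ℂ} [IsFiniteMeasure τ]
    (hτ : Integrable (fun w : ℂ => Real.posLog ‖w‖) τ) (c : ℂ) {r : ℝ} (hr : 0 < r) :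
    Integrable (logIntegral τ) (circleMeasure c r) :=
  (integrable_log_circleMeasure_prod hτ c hr).integral_prod_left

/-- Averages of potentials over circles are integrals of truncated kernels. -/
theorem integral_logIntegral_circleMeasure {τ : Measure ℂ} [IsFiniteMeasure τ]
    (hτ : Integrable (fun w : ℂ => Real.posLog ‖w‖) τ) (c : ℂ) {r : ℝ} (hr : 0 < r) :
    ∫ z, logIntegral τ z ∂(circleMeasure c r)
      = ∫ w, Real.log (max r ‖c - w‖) ∂τ := by
  have h := integral_integral_swap (f := fun z w : ℂ => Real.log ‖z - w‖)
    (integrable_log_circleMeasure_prod hτ c hr)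
  simp only [logIntegral]
  rw [h]
  exact integral_congr_ae (ae_of_all _ fun w => integral_log_circleMeasure c hr w)

/-! ### Truncated potentials -/

theorem abs_log_max_le {r : ℝ} (hr : 0 < r) (x : ℝ) :
    |Real.log (max r x)| ≤ |Real.log r| + Real.posLog x := by
  rcases le_total x r with h | h
  · rw [max_eq_left h]
    linarith [Real.posLog_nonneg (x := x)]
  · rw [max_eq_right h, abs_le]
    have h1 := Real.log_le_log hr h
    have h2 : Real.log x ≤ Real.posLog x := le_max_right _ _
    have h3 := neg_abs_le (Real.log r)
    have h4 := Real.posLog_nonneg (x := x)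
    have h5 := abs_nonneg (Real.log r)
    constructor <;> linarith

theorem continuous_log_max {r : ℝ} (hr : 0 < r) (z : ℂ) :
    Continuous fun w : ℂ => Real.log (max r ‖z - w‖) :=
  Continuous.log (by fun_prop) fun w => (hr.trans_le (le_max_left _ _)).ne'

theorem hasLogGrowth_log_max {r : ℝ} (hr : 0 < r) (z : ℂ) :
    HasLogGrowth fun w : ℂ => Real.log (max r ‖z - w‖) := by
  refine ⟨|Real.log r| + Real.log 2 + Real.posLog ‖z‖, 1, fun w => ?_⟩
  linarith [abs_log_max_le hr ‖z - w‖, posLog_norm_sub_le z w]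

theorem HasLogGrowth.integrable {f : ℂ → ℝ} (hf : HasLogGrowth f) {τ : Measure ℂ}
    [IsFiniteMeasure τ] (hm : AEStronglyMeasurable f τ)
    (hτ : Integrable (fun w : ℂ => Real.posLog ‖w‖) τ) : Integrable f τ := by
  obtain ⟨A, B, h⟩ := hf
  exact ((integrable_const A).add (hτ.const_mul B)).mono' hm (ae_of_all _ h)

theorem integrable_log_max {τ : Measure ℂ} [IsFiniteMeasure τ]
    (hτ : Integrable (fun w : ℂ => Real.posLog ‖w‖) τ) {r : ℝ} (hr : 0 < r) (z : ℂ) :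
    Integrable (fun w : ℂ => Real.log (max r ‖z - w‖)) τ :=
  (hasLogGrowth_log_max hr z).integrable (continuous_log_max hr z).aestronglyMeasurable hτ

theorem log_max_le_log_max_add {r : ℝ} (hr : 0 < r) (z z' w : ℂ) :
    Real.log (max r ‖z' - w‖) ≤ Real.log (max r ‖z - w‖) + ‖z - z'‖ / r := by
  have h1 : 0 < max r ‖z - w‖ := hr.trans_le (le_max_left _ _)
  have h2 : 0 < max r ‖z' - w‖ := hr.trans_le (le_max_left _ _)
  have h3 : max r ‖z' - w‖ ≤ max r ‖z - w‖ + ‖z - z'‖ := by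
    refine max_le ((le_max_left _ _).trans (le_add_of_nonneg_right (norm_nonneg _))) ?_
    calc ‖z' - w‖ = ‖(z - w) - (z - z')‖ := by congr 1; ring
      _ ≤ ‖z - w‖ + ‖z - z'‖ := norm_sub_le _ _
      _ ≤ _ := by gcongr; exact le_max_right _ _
  have h4 := Real.log_le_sub_one_of_pos (div_pos h2 h1)
  rw [Real.log_div h2.ne' h1.ne'] at h4
  have h5 : max r ‖z' - w‖ / max r ‖z - w‖ - 1 ≤ ‖z - z'‖ / r := by
    rw [div_sub_one h1.ne']
    refine div_le_div₀ (norm_nonneg _) (by linarith) hr (le_max_left _ _)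
  linarith

/-- Letting the truncation level tend to zero in nonnegativity of the truncated logarithmic
integrals. -/
theorem logPotential_nonpos_of_truncated {τ : Measure ℂ} [IsFiniteMeasure τ]
    (hτ : Integrable (fun w : ℂ => Real.posLog ‖w‖) τ) {z : ℂ}
    (h : ∀ r, 0 < r → 0 ≤ ∫ w, Real.log (max r ‖z - w‖) ∂τ) : logPotential τ z ≤ 0 := by
  set b : ENNReal := ∫⁻ w, (-logKernel z w).toENNReal ∂τ with hb
  -- the negative part of `log (max r x)`
  let q : ℕ → ℂ → ENNReal := fun n w => ENNReal.ofReal (-Real.log (max (1 / ((n : ℝ) + 1)) ‖z - w‖))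
  have hq : ∀ n, ∫⁻ w, q n w ∂τ ≤ b := by
    intro n
    have hr : (0 : ℝ) < 1 / ((n : ℝ) + 1) := by positivity
    have hi := integrable_log_max hτ hr z
    have h0 := h _ hr
    rw [integral_eq_lintegral_pos_part_sub_lintegral_neg_part hi, sub_nonneg,
      ENNReal.toReal_le_toReal (Integrable.lintegral_lt_top (f := fun w => -Real.log (max (1 / ((n : ℝ) + 1)) ‖z - w‖)) hi.neg).ne
        hi.lintegral_lt_top.ne] at h0
    refine h0.trans (lintegral_mono fun w => ?_)
    have hr1 : 1 / ((n : ℝ) + 1) ≤ 1 := by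
      rw [div_le_one (by positivity)]; linarith [(Nat.cast_nonneg n : (0 : ℝ) ≤ n)]
    rcases le_total ‖z - w‖ (1 / ((n : ℝ) + 1)) with hx | hx
    · rw [max_eq_left hx, ENNReal.ofReal_of_nonpos (Real.log_nonpos hr.le hr1)]
      exact zero_le
    · have hw : w ≠ z := by
        rintro rfl
        rw [sub_self, norm_zero] at hx
        linarith
      rw [max_eq_right hx, logKernel_of_ne hw, ← EReal.coe_neg, EReal.real_coe_toENNReal, neg_neg]
  have hlim : ∀ w, Tendsto (fun n => q n w) atTop (𝓝 (logKernel z w).toENNReal) := by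
    intro w
    have h1 : Tendsto (fun n : ℕ => 1 / ((n : ℝ) + 1)) atTop (𝓝 0) :=
      tendsto_one_div_add_atTop_nhds_zero_nat
    by_cases hw : w = z
    · subst hw
      simp only [q, logKernel_self, sub_self, norm_zero, EReal.toENNReal_top]
      refine ENNReal.tendsto_ofReal_nhds_top.2 (tendsto_neg_atBot_atTop.comp ?_)
      have h2 : ∀ n : ℕ, max (1 / ((n : ℝ) + 1)) 0 = 1 / ((n : ℝ) + 1) := fun n =>
        max_eq_left (by positivity)
      simp only [h2]
      refine Real.tendsto_log_nhdsGT_zero.comp (tendsto_nhdsWithin_iff.2 ⟨h1, ?_⟩)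
      exact Eventually.of_forall fun n => by simp; positivity
    · have hp : 0 < ‖z - w‖ := norm_pos_iff.2 (sub_ne_zero.2 (Ne.symm hw))
      rw [logKernel_of_ne hw, EReal.real_coe_toENNReal]
      refine tendsto_const_nhds.congr' ?_
      filter_upwards [h1.eventually_lt_const hp] with n hn
      simp only [q]
      rw [max_eq_right hn.le]
  have hle : ∫⁻ w, (logKernel z w).toENNReal ∂τ ≤ b := by
    calc ∫⁻ w, (logKernel z w).toENNReal ∂τ
        = ∫⁻ w, liminf (fun n => q n w) atTop ∂τ := by
          exact lintegral_congr fun w => (hlim w).liminf_eq.symm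
      _ ≤ liminf (fun n => ∫⁻ w, q n w ∂τ) atTop := by
          refine lintegral_liminf_le fun n => ?_
          exact ((continuous_log_max (by positivity) z).neg.measurable).ennreal_ofReal
      _ ≤ b := liminf_le_of_le (by isBoundedDefault) fun c hc => by
          obtain ⟨n, hn⟩ := hc.exists
          exact hn.trans (hq n)
  rw [logPotential, erealIntegral]
  exact EReal.sub_nonpos.2 (by exact_mod_cast hle)

/-- Where the potential is nonpositive, it is a convergent integral. -/
theorem integrable_log_of_logPotential_nonpos {τ : Measure ℂ} [IsFiniteMeasure τ]
    (hτ : Integrable (fun w : ℂ => Real.posLog ‖w‖) τ) {z : ℂ} (h : logPotential τ z ≤ 0) :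
    τ {z} = 0 ∧ Integrable (fun w => Real.log ‖z - w‖) τ ∧ 0 ≤ logIntegral τ z := by
  obtain ⟨h1, h2⟩ := integrable_log_of_logPotential_ne_top hτ (ne_top_of_le_ne_top (by simp) h)
  refine ⟨h2, h1, ?_⟩
  rw [logPotential_eq_coe h1 h2] at h
  have : -logIntegral τ z ≤ 0 := by unfold logIntegral; exact_mod_cast h
  linarith

/-! ### The maximum principle for potentials -/

/-- A property that holds almost everywhere on a circle holds at a point of a given arc. -/
theorem exists_of_ae_circleMeasure {c : ℂ} {r : ℝ} {p : ℂ → Prop}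
    (h : ∀ᵐ z ∂(circleMeasure c r), p z) : ∃ θ ∈ Set.Ioo (0 : ℝ) 1, p (circleMap c r θ) := by
  have h1 := ae_of_ae_map (measurable_circleMap' c r).aemeasurable h
  rw [Measure.ae_ennreal_smul_measure_iff
    (ENNReal.inv_ne_zero.2 ENNReal.ofReal_ne_top), ae_restrict_iff' measurableSet_Ioc] at h1
  by_contra! hc
  have h2 : volume (Set.Ioo (0 : ℝ) 1) = 0 := by
    refine measure_mono_null (fun θ hθ => ?_) (ae_iff.1 h1)
    have : θ ∈ Set.Ioc 0 (2 * Real.pi) :=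
      ⟨hθ.1, by have := Real.pi_gt_three; have := hθ.2; linarith⟩
    simpa [this.1, this.2] using hc θ hθ
  simp at h2

theorem continuousAt_logIntegral {S : Set ℂ} (hS : IsCompact S) {τ : Measure ℂ}
    [IsFiniteMeasure τ] (hτ : ∀ᵐ w ∂τ, w ∈ S) {z : ℂ} (hz : z ∉ S) :
    ContinuousAt (logIntegral τ) z := by
  obtain ⟨R, hR⟩ := hS.isBounded.exists_norm_le
  obtain ⟨d, hd, hdS⟩ := Metric.isOpen_iff.1 hS.isClosed.isOpen_compl z hz
  have hfar : ∀ w ∈ S, d ≤ ‖z - w‖ := by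
    intro w hw
    by_contra! hlt
    exact hdS (by rwa [Metric.mem_ball, dist_comm, dist_eq_norm]) hw
  refine continuousAt_of_dominated
    (bound := fun _ => |Real.log (d / 2)| + Real.posLog (‖z‖ + d / 2 + R)) ?_ ?_ ?_ ?_
  · exact Eventually.of_forall fun z' => (measurable_log_norm_const_sub z').aestronglyMeasurable
  · filter_upwards [Metric.ball_mem_nhds z (half_pos hd)] with z' hz'
    filter_upwards [hτ] with w hw
    rw [Metric.mem_ball, dist_eq_norm] at hz'
    have h1 := hfar w hw
    have h2 : ‖z - w‖ ≤ ‖z' - z‖ + ‖z' - w‖ := by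
      calc ‖z - w‖ = ‖(z' - w) - (z' - z)‖ := by congr 1; ring
        _ ≤ ‖z' - w‖ + ‖z' - z‖ := norm_sub_le _ _
        _ = _ := add_comm _ _
    have h3 : ‖z' - w‖ ≤ ‖z‖ + d / 2 + R := by
      calc ‖z' - w‖ = ‖z + (z' - z) - w‖ := by congr 1; ring
        _ ≤ ‖z‖ + ‖z' - z‖ + ‖w‖ := (norm_sub_le _ _).trans (by gcongr; exact norm_add_le _ _)
        _ ≤ _ := by have := hR w hw; linarith
    have h4 := abs_log_max_le (half_pos hd) ‖z' - w‖
    rw [max_eq_right (by linarith)] at h4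
    have h5 := Real.posLog_le_posLog (norm_nonneg _) h3
    rw [Real.norm_eq_abs]; linarith
  · exact integrable_const _
  · filter_upwards [hτ] with w hw
    have : z - w ≠ 0 := by
      intro h0
      have := hfar w hw
      rw [h0, norm_zero] at this; linarith
    exact ContinuousAt.log (by fun_prop) (norm_ne_zero_iff.2 this)

theorem integrable_log_of_notMem {S : Set ℂ} (hS : IsCompact S) {τ : Measure ℂ}
    [IsFiniteMeasure τ] (hτ : ∀ᵐ w ∂τ, w ∈ S) {z : ℂ} (hz : z ∉ S) :
    Integrable (fun w => Real.log ‖z - w‖) τ := by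
  obtain ⟨R, hR⟩ := hS.isBounded.exists_norm_le
  obtain ⟨d, hd, hdS⟩ := Metric.isOpen_iff.1 hS.isClosed.isOpen_compl z hz
  refine (integrable_const (|Real.log d| + Real.posLog (‖z‖ + R))).mono'
    (measurable_log_norm_const_sub z).aestronglyMeasurable ?_
  filter_upwards [hτ] with w hw
  have h1 : d ≤ ‖z - w‖ := by
    by_contra! hlt
    exact hdS (by rwa [Metric.mem_ball, dist_comm, dist_eq_norm]) hw
  have h4 := abs_log_max_le hd ‖z - w‖
  rw [max_eq_right h1] at h4
  have h3 : ‖z - w‖ ≤ ‖z‖ + R := (norm_sub_le _ _).trans (by gcongr; exact hR w hw)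
  have h5 := Real.posLog_le_posLog (norm_nonneg _) h3
  rw [Real.norm_eq_abs]; linarith

/-- Boundary behaviour of the potential at its support (continuity principle): comparison with the
point of `S` nearest to `z` costs at most `log 2` times the mass of a small disc, which is small
since there are no atoms. -/
theorem exists_lower_bound_near {S : Set ℂ} (hS : IsCompact S) {τ : Measure ℂ}
    [IsFiniteMeasure τ] (hτ : ∀ᵐ w ∂τ, w ∈ S)
    (h : ∀ z ∈ S, τ {z} = 0 ∧ Integrable (fun w => Real.log ‖z - w‖) τ ∧ 0 ≤ logIntegral τ z)
    {ζ : ℂ} (hζ : ζ ∈ S) {η : ℝ} (hη : 0 < η) (hm : τ.real Set.univ ≤ 1) :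
    ∀ᶠ z in 𝓝 ζ, z ∉ S → -η ≤ logIntegral τ z := by
  obtain ⟨U, hU, hUo, hUm⟩ := Set.exists_isOpen_lt_of_lt (μ := τ) {ζ} (ENNReal.ofReal (η / 2))
    (by rw [(h ζ hζ).1]; simpa using hη)
  obtain ⟨r, hr, hrU⟩ := Metric.isOpen_iff.1 hUo ζ (hU rfl)
  have hUr : τ.real U ≤ η / 2 := ENNReal.toReal_le_of_le_ofReal (by positivity) hUm.le
  -- far from `ζ` the kernels at `z` and at its nearest point differ by at most `δ / (r / 2) ≤ η / 2`
  set δ : ℝ := min (r / 2) (η * r / 4) with hδ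
  have hδ0 : 0 < δ := by positivity
  filter_upwards [Metric.ball_mem_nhds ζ hδ0] with z hz hzS
  rw [Metric.mem_ball, dist_eq_norm] at hz
  obtain ⟨z', hz'S, hz'⟩ := hS.exists_isMinOn ⟨ζ, hζ⟩
    (f := fun w => ‖z - w‖) (by fun_prop)
  have hmin : ∀ w ∈ S, ‖z - z'‖ ≤ ‖z - w‖ := fun w hw => hz' hw
  obtain ⟨ha, hi', h0'⟩ := h z' hz'S
  have hi := integrable_log_of_notMem hS hτ hzS
  have hne : ∀ᵐ w ∂τ, w ≠ z' := by simpa [ae_iff] using ha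
  have hzz' : ‖z - z'‖ < δ := (hmin ζ hζ).trans_lt hz
  have hpt : ∀ᵐ w ∂τ, Real.log ‖z' - w‖ ≤
      Real.log ‖z - w‖ + (U.indicator (fun _ => (1 : ℝ)) w + η / 2) := by
    filter_upwards [hne, hτ] with w hw hwS
    have hp : 0 < ‖z' - w‖ := norm_pos_iff.2 (sub_ne_zero.2 hw.symm)
    have hq : 0 < ‖z - w‖ := norm_pos_iff.2 (sub_ne_zero.2 fun e => hzS (e ▸ hwS))
    have htri : ‖z' - w‖ ≤ ‖z - w‖ + ‖z - z'‖ := by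
      calc ‖z' - w‖ = ‖(z - w) - (z - z')‖ := by congr 1; ring
        _ ≤ _ := norm_sub_le _ _
    have hlog := Real.log_le_sub_one_of_pos (div_pos hp hq)
    rw [Real.log_div hp.ne' hq.ne', div_sub_one hq.ne'] at hlog
    by_cases hwU : w ∈ U
    · rw [Set.indicator_of_mem hwU]
      have : (‖z' - w‖ - ‖z - w‖) / ‖z - w‖ ≤ 1 := by
        rw [div_le_one hq]; linarith [hmin w hwS]
      linarith
    · rw [Set.indicator_of_notMem hwU]
      have h1 : r ≤ ‖w - ζ‖ := by
        by_contra! hlt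
        exact hwU (hrU (by rwa [Metric.mem_ball, dist_eq_norm]))
      have h2 : ‖w - ζ‖ ≤ ‖z - w‖ + ‖z - ζ‖ := by
        calc ‖w - ζ‖ = ‖(z - ζ) - (z - w)‖ := by congr 1; ring
          _ ≤ ‖z - ζ‖ + ‖z - w‖ := norm_sub_le _ _
          _ = _ := add_comm _ _
      have h3 : r / 2 ≤ ‖z - w‖ := by linarith [min_le_left (r / 2) (η * r / 4)]
      have : (‖z' - w‖ - ‖z - w‖) / ‖z - w‖ ≤ η / 2 := by
        rw [div_le_iff₀ hq]
        have h4 : η * r / 4 ≤ η / 2 * ‖z - w‖ := by nlinarith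
        linarith [min_le_right (r / 2) (η * r / 4)]
      linarith
  have hind : Integrable (U.indicator (fun _ => (1 : ℝ))) τ :=
    (integrable_const 1).indicator hUo.measurableSet
  have hint := integral_mono_ae hi' (hi.add (hind.add (integrable_const (η / 2)))) hpt
  rw [integral_add' hi (hind.add (integrable_const (η / 2))),
    integral_add' hind (integrable_const (η / 2)),
    integral_indicator_const _ hUo.measurableSet, integral_const] at hint
  simp only [smul_eq_mul, mul_one] at hint
  unfold logIntegral at h0' ⊢
  nlinarith

/-- The sublevel sets `{g ≤ c}`, `c < 0`, of the logarithmic integral are compact. -/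
theorem isCompact_setOf_logIntegral_le {S : Set ℂ} (hS : IsCompact S) {τ : Measure ℂ}
    [IsProbabilityMeasure τ] (hτ : ∀ᵐ w ∂τ, w ∈ S)
    (h : ∀ z ∈ S, τ {z} = 0 ∧ Integrable (fun w => Real.log ‖z - w‖) τ ∧ 0 ≤ logIntegral τ z)
    {c : ℝ} (hc : c < 0) : IsCompact {z | z ∉ S ∧ logIntegral τ z ≤ c} := by
  obtain ⟨R, hR⟩ := hS.isBounded.exists_norm_le
  refine (isCompact_closedBall (0 : ℂ) (R + 1)).of_isClosed_subset ?_ ?_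
  · rw [← isOpen_compl_iff, isOpen_iff_mem_nhds]
    intro z hz
    by_cases hzS : z ∈ S
    · filter_upwards [exists_lower_bound_near hS hτ h hzS (η := -c / 2) (by linarith)
        (by simp)] with z' hz' hmem
      have := hz' hmem.1
      have := hmem.2
      linarith
    · have hlt : c < logIntegral τ z := by
        by_contra! hle
        exact hz ⟨hzS, hle⟩
      filter_upwards [(continuousAt_logIntegral hS hτ hzS).eventually (lt_mem_nhds hlt)]
        with z' hz' hmem
      exact absurd hmem.2 (not_le.2 hz')
  · rintro z ⟨-, hz⟩
    rw [mem_closedBall_zero_iff]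
    by_contra! hlt
    have : 0 ≤ logIntegral τ z := by
      refine integral_nonneg_of_ae ?_
      filter_upwards [hτ] with w hw
      refine Real.log_nonneg ?_
      have h1 := hR w hw
      have h2 := norm_sub_norm_le z w
      linarith
    linarith

/-- The maximum principle: a potential that is nonpositive on the support is nonpositive
everywhere. At a global minimum of the logarithmic integral off `S` the mean value property makes
the integral constant on a small circle, which contradicts the choice of the minimum point. -/
theorem logIntegral_nonneg_of_support {S : Set ℂ} (hS : IsCompact S) {τ : Measure ℂ}
    [IsProbabilityMeasure τ] (hτ : ∀ᵐ w ∂τ, w ∈ S)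
    (h : ∀ z ∈ S, τ {z} = 0 ∧ Integrable (fun w => Real.log ‖z - w‖) τ ∧ 0 ≤ logIntegral τ z)
    (z : ℂ) : 0 ≤ logIntegral τ z := by
  by_contra! hneg
  have hzS : z ∉ S := fun hz => not_le.2 hneg (h z hz).2.2
  have hcont : ContinuousOn (logIntegral τ) Sᶜ := fun w hw =>
    (continuousAt_logIntegral hS hτ hw).continuousWithinAt
  obtain ⟨z₁, hz₁, hmin⟩ := (isCompact_setOf_logIntegral_le hS hτ h hneg).exists_isMinOn
    ⟨z, hzS, le_rfl⟩ (hcont.mono fun w hw => hw.1)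
  set m := logIntegral τ z₁ with hm
  have hm0 : m < 0 := hz₁.2.trans_lt hneg
  have hglob : ∀ w, m ≤ logIntegral τ w := by
    intro w
    by_cases hw : w ∈ S
    · exact hm0.le.trans (h w hw).2.2
    · by_cases hw' : logIntegral τ w ≤ logIntegral τ z
      · exact hmin ⟨hw, hw'⟩
      · exact hz₁.2.trans (not_le.1 hw').le
  -- the minimum point with the largest real part
  obtain ⟨z₂, hz₂, hmax⟩ := (isCompact_setOf_logIntegral_le hS hτ h hm0).exists_isMaxOn
    ⟨z₁, hz₁.1, le_rfl⟩ Complex.continuous_re.continuousOn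
  have hz₂m : logIntegral τ z₂ = m := le_antisymm hz₂.2 (hglob z₂)
  obtain ⟨d, hd, hdS⟩ := Metric.isOpen_iff.1 hS.isClosed.isOpen_compl z₂ hz₂.1
  have hK : τ ∈ probMeasuresOn S := ⟨inferInstance, hτ⟩
  have hlog := integrable_posLog_of_bounded hS.isBounded hK
  have hr : 0 < d / 2 := half_pos hd
  have havg : ∫ w, (logIntegral τ w - m) ∂(circleMeasure z₂ (d / 2)) = 0 := by
    rw [integral_sub (integrable_logIntegral_circleMeasure hlog z₂ hr) (integrable_const m),
      integral_logIntegral_circleMeasure hlog z₂ hr, ← hz₂m]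
    simp only [integral_const, probReal_univ, smul_eq_mul, one_mul]
    rw [sub_eq_zero]
    refine integral_congr_ae ?_
    filter_upwards [hτ] with w hw
    rw [max_eq_right]
    by_contra! hlt
    refine hdS ?_ hw
    rw [Metric.mem_ball, dist_comm, dist_eq_norm]
    linarith
  rw [integral_eq_zero_iff_of_nonneg (fun w => sub_nonneg.2 (hglob w))
    ((integrable_logIntegral_circleMeasure hlog z₂ hr).sub (integrable_const m))] at havg
  obtain ⟨θ, hθ, hp⟩ := exists_of_ae_circleMeasure havg
  have hnS : circleMap z₂ (d / 2) θ ∉ S := by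
    refine hdS ?_
    rw [Metric.mem_ball, dist_eq_norm, circleMap_sub_center, norm_circleMap_zero, abs_of_pos hr]
    linarith
  have hre := hmax (show circleMap z₂ (d / 2) θ ∈ _ from ⟨hnS, by simpa [sub_eq_zero] using hp.le⟩)
  have hcos : 0 < Real.cos θ := Real.cos_pos_of_mem_Ioo
    ⟨by linarith [hθ.1, Real.pi_pos], by linarith [hθ.2, Real.pi_gt_three]⟩
  have hre' : (circleMap z₂ (d / 2) θ).re = z₂.re + d / 2 * Real.cos θ := by
    simp [circleMap, Complex.exp_ofReal_mul_I_re]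
  simp only [Set.mem_ofPred_eq, hre'] at hre
  nlinarith

/-! ### Frostman's theorem for equilibrium measures of energy zero -/

/-- The energy of the mixture `s ν + t α`, expanded as a quadratic form. -/
theorem logEnergy_nonneg_perturbation {ν α : Measure ℂ} [IsProbabilityMeasure ν]
    [IsFiniteMeasure α] (hα : α ≤ ν) {K : Set ℂ} (hν : ν Kᶜ = 0)
    (hi : Integrable (fun p : ℂ × ℂ => Real.log ‖p.1 - p.2‖) (ν.prod ν))
    (hd : ∀ z, ν {z} = 0)
    (hmin : ∀ τ ∈ probMeasuresOn K, 0 ≤ logEnergy τ) {s t : ℝ} (hs : 0 ≤ s) (ht : 0 ≤ t)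
    (hst : s + t * α.real Set.univ = 1) :
    s ^ 2 * ∫ p, Real.log ‖p.1 - p.2‖ ∂(ν.prod ν)
      + 2 * (s * t) * ∫ p, Real.log ‖p.1 - p.2‖ ∂(α.prod ν)
      + t ^ 2 * ∫ p, Real.log ‖p.1 - p.2‖ ∂(α.prod α) ≤ 0 := by
  set L : ℂ × ℂ → ℝ := fun p => Real.log ‖p.1 - p.2‖ with hL
  have h1 : α.prod ν ≤ ν.prod ν := Measure.prod_mono hα le_rfl
  have h2 : ν.prod α ≤ ν.prod ν := Measure.prod_mono le_rfl hα
  have h3 : α.prod α ≤ ν.prod ν := Measure.prod_mono hα hα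
  set τ : Measure ℂ := ENNReal.ofReal s • ν + ENNReal.ofReal t • α with hτ
  have hprod : τ.prod τ = (ENNReal.ofReal s * ENNReal.ofReal s) • ν.prod ν
      + (ENNReal.ofReal s * ENNReal.ofReal t) • ν.prod α
      + ((ENNReal.ofReal s * ENNReal.ofReal t) • α.prod ν
      + (ENNReal.ofReal t * ENNReal.ofReal t) • α.prod α) := by
    rw [hτ, Measure.prod_add, Measure.add_prod, Measure.add_prod]
    simp only [Measure.prod_smul_left, Measure.prod_smul_right, smul_smul]
    rw [mul_comm (ENNReal.ofReal t) (ENNReal.ofReal s)]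
    abel
  have hsw : ∫ p, L p ∂(ν.prod α) = ∫ p, L p ∂(α.prod ν) := by
    rw [← integral_prod_swap]
    simp only [hL, Prod.fst_swap, Prod.snd_swap]
    exact integral_congr_ae (ae_of_all _ fun p => by simp only [norm_sub_rev])
  have hint : Integrable L (τ.prod τ) := by
    rw [hprod]
    refine ((hi.smul_measure ?_).add_measure ((hi.mono_measure h2).smul_measure ?_)).add_measure
      (((hi.mono_measure h1).smul_measure ?_).add_measure
        ((hi.mono_measure h3).smul_measure ?_)) <;> finiteness
  have hτp : IsProbabilityMeasure τ := by
    refine ⟨?_⟩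
    rw [hτ, Measure.add_apply, Measure.smul_apply, Measure.smul_apply, measure_univ, smul_eq_mul,
      smul_eq_mul, mul_one, ← ofReal_measureReal, ← ENNReal.ofReal_mul ht,
      ← ENNReal.ofReal_add hs (by positivity), hst, ENNReal.ofReal_one]
  have hαz : ∀ B, ν B = 0 → α B = 0 := fun B hB => le_antisymm ((hα B).trans hB.le) zero_le
  have hτz : ∀ B, ν B = 0 → τ B = 0 := fun B hB => by
    rw [hτ, Measure.add_apply, Measure.smul_apply, Measure.smul_apply, hB, hαz B hB]; simp
  have h0 := hmin τ ⟨hτp, hτz _ hν⟩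
  rw [logEnergy_eq_coe hint (ae_of_all _ fun z => hτz _ (hd z))] at h0
  have h0' : ∫ p, L p ∂(τ.prod τ) ≤ 0 := by
    have : (0 : ℝ) ≤ -∫ p, L p ∂(τ.prod τ) := by exact_mod_cast h0
    linarith
  rw [hprod, integral_add_measure, integral_add_measure, integral_add_measure,
    integral_smul_measure, integral_smul_measure, integral_smul_measure, integral_smul_measure,
    hsw] at h0'
  · simp only [ENNReal.toReal_mul, ENNReal.toReal_ofReal hs, ENNReal.toReal_ofReal ht,
      smul_eq_mul] at h0'
    linarith
  · exact (hi.mono_measure h1).smul_measure (by finiteness)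
  · exact (hi.mono_measure h3).smul_measure (by finiteness)
  · exact hi.smul_measure (by finiteness)
  · exact (hi.mono_measure h2).smul_measure (by finiteness)
  · exact (hi.smul_measure (by finiteness)).add_measure
      ((hi.mono_measure h2).smul_measure (by finiteness))
  · exact ((hi.mono_measure h1).smul_measure (by finiteness)).add_measure
      ((hi.mono_measure h3).smul_measure (by finiteness))

/-- The potential of a minimizer of energy zero vanishes almost everywhere for the minimizer. -/
theorem logIntegral_ae_eq_zero {ν : Measure ℂ} [IsProbabilityMeasure ν] {K : Set ℂ}
    (hν : ν Kᶜ = 0)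
    (hi : Integrable (fun p : ℂ × ℂ => Real.log ‖p.1 - p.2‖) (ν.prod ν))
    (hd : ∀ z, ν {z} = 0) (h0 : ∫ p, Real.log ‖p.1 - p.2‖ ∂(ν.prod ν) = 0)
    (hmin : ∀ τ ∈ probMeasuresOn K, 0 ≤ logEnergy τ) :
    ∀ᵐ z ∂ν, logIntegral ν z = 0 := by
  have hg : Integrable (logIntegral ν) ν := hi.integral_prod_left
  have hA : ∀ A, MeasurableSet A → ∫ z in A, logIntegral ν z ∂ν ≤ 0 := by
    intro A hA
    have hr : ν.restrict A ≤ ν := Measure.restrict_le_self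
    set Q := ∫ z in A, logIntegral ν z ∂ν with hQ
    have hQ' : ∫ p, Real.log ‖p.1 - p.2‖ ∂((ν.restrict A).prod ν) = Q :=
      integral_prod _ (hi.mono_measure (Measure.prod_mono hr le_rfl))
    set R := ∫ p, Real.log ‖p.1 - p.2‖ ∂((ν.restrict A).prod (ν.restrict A)) with hR
    set a := ν.real A with ha
    by_contra! hpos
    -- a mixture with a small weight `x` on `A`
    have key : ∀ x : ℝ, 0 < x → x < 1 → 2 * (1 - x * a) * Q + x * R ≤ 0 := by
      intro x hx hx1
      have ha1 : a ≤ 1 := measureReal_le_one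
      have ha0 : 0 ≤ a := measureReal_nonneg
      have := logEnergy_nonneg_perturbation hr hν hi hd hmin (s := 1 - x * a) (t := x)
        (by nlinarith) hx.le (by simp [ha])
      rw [h0, hQ', ← hR] at this
      have h2 : x * (2 * (1 - x * a) * Q + x * R) ≤ x * 0 := by linarith
      exact le_of_mul_le_mul_left h2 hx
    have hc : Tendsto (fun x : ℝ => 2 * (1 - x * a) * Q + x * R) (𝓝[>] 0) (𝓝 (2 * Q)) := by
      have : Continuous fun x : ℝ => 2 * (1 - x * a) * Q + x * R := by fun_prop
      simpa using (this.tendsto 0).mono_left nhdsWithin_le_nhds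
    have := le_of_tendsto hc (by
      filter_upwards [Ioo_mem_nhdsGT (zero_lt_one (α := ℝ))] with x hx
      exact key x hx.1 hx.2)
    linarith
  have hneg : 0 ≤ᵐ[ν] fun z => -logIntegral ν z := by
    refine ae_nonneg_of_forall_setIntegral_nonneg hg.neg fun s hs _ => ?_
    rw [integral_neg]
    linarith [hA s hs]
  have hz : ∫ z, -logIntegral ν z ∂ν = 0 := by
    rw [integral_prod _ hi] at h0
    rw [integral_neg, neg_eq_zero]
    exact h0
  rw [integral_eq_zero_iff_of_nonneg_ae hneg hg.neg] at hz
  filter_upwards [hz] with z hz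
  simpa using hz

theorem measure_singleton_eq_zero_of_ae {τ : Measure ℂ} (h : ∀ᵐ z ∂τ, τ {z} = 0) (z : ℂ) :
    τ {z} = 0 := by
  by_contra hne
  have h1 : ∀ᵐ w ∂(τ.restrict {z}), τ {w} = 0 := ae_restrict_of_ae h
  rw [Measure.restrict_singleton] at h1
  have h2 := (Measure.ae_ennreal_smul_measure_iff hne).1 h1
  rw [ae_dirac_eq] at h2
  exact hne h2

theorem log_norm_le_log_max {r : ℝ} {z w : ℂ} (h : w ≠ z) :
    Real.log ‖z - w‖ ≤ Real.log (max r ‖z - w‖) :=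
  Real.log_le_log (norm_pos_iff.2 (sub_ne_zero.2 h.symm)) (le_max_right _ _)

theorem logIntegral_le_truncated {τ : Measure ℂ} [IsFiniteMeasure τ]
    (hτ : Integrable (fun w : ℂ => Real.posLog ‖w‖) τ) {z : ℂ} (hz : τ {z} = 0)
    (hi : Integrable (fun w => Real.log ‖z - w‖) τ) {r : ℝ} (hr : 0 < r) :
    logIntegral τ z ≤ ∫ w, Real.log (max r ‖z - w‖) ∂τ := by
  refine integral_mono_ae hi (integrable_log_max hτ hr z) ?_
  have : ∀ᵐ w ∂τ, w ≠ z := by simpa [ae_iff] using hz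
  exact this.mono fun w hw => log_norm_le_log_max hw

/-- The potential of an equilibrium measure of energy zero is nonpositive everywhere, stated for
the truncated kernels. -/
theorem truncated_nonneg_of_equilibrium {K : Set ℂ} (hK : IsCompact K) {ν : Measure ℂ}
    (hν : ν ∈ probMeasuresOn K) (h0 : logEnergy ν = 0)
    (hmin : ∀ τ ∈ probMeasuresOn K, logEnergy ν ≤ logEnergy τ) (z : ℂ) {r : ℝ} (hr : 0 < r) :
    0 ≤ ∫ w, Real.log (max r ‖z - w‖) ∂ν := by
  have := hν.1
  have hlog := integrable_posLog_of_bounded hK.isBounded hν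
  obtain ⟨hi, hd⟩ := integrable_log_prod_of_logEnergy_ne_top hK.isBounded hν (by simp [h0])
  have hE := logEnergy_eq_coe hi hd
  rw [h0] at hE
  have hE0 : ∫ p, Real.log ‖p.1 - p.2‖ ∂(ν.prod ν) = 0 := by
    have : (0 : ℝ) = -∫ p, Real.log ‖p.1 - p.2‖ ∂(ν.prod ν) := by exact_mod_cast hE
    linarith
  have hatom := measure_singleton_eq_zero_of_ae hd
  have hae := logIntegral_ae_eq_zero hν.2 hi hatom hE0 (fun τ hτ => h0 ▸ hmin τ hτ)
  set S := ν.support with hS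
  have hSK : S ⊆ K := Measure.support_subset_of_isClosed hK.isClosed hν.2
  have hSc : IsCompact S := hK.of_isClosed_subset (Measure.isClosed_support) hSK
  have hSae : ∀ᵐ w ∂ν, w ∈ S := Measure.support_mem_ae
  -- points of the support are limits of points where the potential vanishes
  have hSt : ∀ z ∈ S, ∀ r, 0 < r → 0 ≤ ∫ w, Real.log (max r ‖z - w‖) ∂ν := by
    intro z hz r hr
    refine le_of_forall_pos_le_add fun ε hε => ?_
    have hball : 0 < ν (Metric.ball z (ε * r)) :=
      (Measure.mem_support_iff_forall z).1 hz _ (Metric.ball_mem_nhds z (by positivity))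
    obtain ⟨z', hz'b, hz'0, hz'i⟩ : ∃ z' ∈ Metric.ball z (ε * r), logIntegral ν z' = 0 ∧
        Integrable (fun w => Real.log ‖z' - w‖) ν := by
      by_contra! hcon
      refine hball.ne' (measure_mono_null (fun z' hz' => ?_) (ae_iff.1 (hae.and hi.prod_right_ae)))
      intro hh
      exact hcon z' hz' hh.1 hh.2
    have h1 := logIntegral_le_truncated hlog (hatom z') hz'i hr
    have h2 : ∫ w, Real.log (max r ‖z' - w‖) ∂ν ≤ ∫ w, (Real.log (max r ‖z - w‖) + ε) ∂ν := by
      refine integral_mono (integrable_log_max hlog hr z')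
        ((integrable_log_max hlog hr z).add (integrable_const ε)) fun w => ?_
      refine (log_max_le_log_max_add hr z z' w).trans ?_
      gcongr
      rw [div_le_iff₀ hr, ← dist_eq_norm, dist_comm]
      exact (Metric.mem_ball.1 hz'b).le
    rw [integral_add (integrable_log_max hlog hr z) (integrable_const ε)] at h2
    simp only [integral_const, probReal_univ, smul_eq_mul, one_mul] at h2
    linarith
  have hsupp : ∀ z ∈ S, ν {z} = 0 ∧ Integrable (fun w => Real.log ‖z - w‖) ν ∧
      0 ≤ logIntegral ν z := by
    intro z hz
    exact integrable_log_of_logPotential_nonpos hlog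
      (logPotential_nonpos_of_truncated hlog (hSt z hz))
  by_cases hz : z ∈ S
  · exact hSt z hz r hr
  · exact (logIntegral_nonneg_of_support hSc hSae hsupp z).trans
      (logIntegral_le_truncated hlog (hatom z) (integrable_log_of_notMem hSc hSae hz) hr)

/-- The principle of descent. -/
theorem logPotential_nonpos_of_tendsto {μ : Measure ℂ} {K : ℕ → Set ℂ} {ν : ℕ → Measure ℂ}
    (h : ∀ n, IsCompact (K n) ∧ logCapacity (K n) = 1 ∧ IsEquilibriumMeasure (K n) (ν n))
    (hlim : LogWeakTendsto ν μ) (z : ℂ) : logPotential μ z ≤ 0 := by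
  have := hlim.2.1.1
  refine logPotential_nonpos_of_truncated hlim.2.1.2 fun r hr => ?_
  refine ge_of_tendsto' (hlim.2.2 _ (continuous_log_max hr z) (hasLogGrowth_log_max hr z))
    fun n => ?_
  obtain ⟨hc, hcap, -, hmem, hmin⟩ := h n
  refine truncated_nonneg_of_equilibrium hc hmem ?_ hmin z hr
  have hinf : ⨅ τ ∈ probMeasuresOn (K n), logEnergy τ = logEnergy (ν n) :=
    le_antisymm (iInf₂_le _ hmem) (le_iInf₂ hmin)
  rw [logCapacity, hinf, ← EReal.exp_zero] at hcap
  simpa using EReal.exp_strictMono.injective hcap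

/-! ### The equilibrium measure of a polynomial lemniscate -/

/-- The finite set of solutions `ζ` of `P(ζ) = ξ`. -/
noncomputable def fiberFinset (P : Polynomial ℂ) (ξ : ℂ) : Finset ℂ :=
  (P - Polynomial.C ξ).roots.toFinset

theorem sub_C_ne_zero {P : Polynomial ℂ} (hP : P.natDegree ≠ 0) (ξ : ℂ) :
    P - Polynomial.C ξ ≠ 0 := by
  intro h
  apply hP
  rw [sub_eq_zero] at h
  rw [h, Polynomial.natDegree_C]

theorem mem_fiberFinset {P : Polynomial ℂ} (hP : P.natDegree ≠ 0) {ξ ζ : ℂ} :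
    ζ ∈ fiberFinset P ξ ↔ P.eval ζ = ξ := by
  rw [fiberFinset, Multiset.mem_toFinset, Polynomial.mem_roots (sub_C_ne_zero hP ξ),
    Polynomial.IsRoot.def, Polynomial.eval_sub, Polynomial.eval_C, sub_eq_zero]

/-- The counting measure on the fibre of `P` over `ξ`, without multiplicities. -/
noncomputable def fiberMeasure (P : Polynomial ℂ) (ξ : ℂ) : Measure ℂ :=
  ∑ ζ ∈ fiberFinset P ξ, Measure.dirac ζ

instance isFiniteMeasure_fiberMeasure (P : Polynomial ℂ) (ξ : ℂ) :
    IsFiniteMeasure (fiberMeasure P ξ) := by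
  unfold fiberMeasure; infer_instance

open Classical in
theorem fiberMeasure_apply (P : Polynomial ℂ) (ξ : ℂ) {A : Set ℂ} (hA : MeasurableSet A) :
    fiberMeasure P ξ A = (((fiberFinset P ξ).filter (· ∈ A)).card : ENNReal) := by
  rw [fiberMeasure, Measure.finsetSum_apply, Finset.card_filter]
  push_cast
  refine Finset.sum_congr rfl fun ζ _ => ?_
  rw [Measure.dirac_apply' _ hA]
  by_cases h : ζ ∈ A <;> simp [h]

/-- The number of preimages in an open set is lower semicontinuous, because nonconstant
polynomials are open maps. -/
theorem lowerSemicontinuous_fiberMeasure {P : Polynomial ℂ} (hP : P.natDegree ≠ 0) {A : Set ℂ}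
    (hA : IsOpen A) : LowerSemicontinuous fun ξ => fiberMeasure P ξ A := by
  classical
  intro ξ₀ y hy
  set T := (fiberFinset P ξ₀).filter (· ∈ A) with hT
  obtain ⟨U, hU, hdisj⟩ := T.finite_toSet.t2_separation
  have hopen := (P.isOpenQuotientMap_eval hP).isOpenMap
  have hev : ∀ᶠ ξ in 𝓝 ξ₀, ∀ ζ ∈ T, ξ ∈ P.eval '' (U ζ ∩ A) := by
    rw [Finset.eventually_all]
    intro ζ hζ
    rw [hT, Finset.mem_filter, mem_fiberFinset hP] at hζ
    exact (hopen _ ((hU ζ).2.inter hA)).mem_nhds ⟨ζ, ⟨(hU ζ).1, hζ.2⟩, hζ.1⟩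
  filter_upwards [hev] with ξ hξ
  refine hy.trans_le ?_
  change fiberMeasure P ξ₀ A ≤ fiberMeasure P ξ A
  rw [fiberMeasure_apply P ξ₀ hA.measurableSet, fiberMeasure_apply P ξ hA.measurableSet]
  have hch : ∀ ζ, ∃ ζ', ζ ∈ T → ζ' ∈ U ζ ∩ A ∧ P.eval ζ' = ξ := by
    intro ζ
    by_cases h : ζ ∈ T
    · obtain ⟨ζ', h1, h2⟩ := hξ ζ h
      exact ⟨ζ', fun _ => ⟨h1, h2⟩⟩
    · exact ⟨0, fun h' => absurd h' h⟩
  choose φ hφ using hch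
  refine Nat.cast_le.2 (Finset.card_le_card_of_injOn φ ?_ ?_)
  · intro ζ hζ
    have := hφ ζ hζ
    rw [Finset.mem_coe, Finset.mem_filter, mem_fiberFinset hP]
    exact ⟨this.2, this.1.2⟩
  · intro ζ hζ ζ' hζ' heq
    by_contra hne
    exact (Set.disjoint_left.1 (hdisj hζ hζ' hne)) (hφ ζ hζ).1.1 (heq ▸ (hφ ζ' hζ').1.1)

theorem measurable_fiberMeasure {P : Polynomial ℂ} (hP : P.natDegree ≠ 0) :
    Measurable (fiberMeasure P) :=
  Measurable.measure_of_isPiSystem (S := {A | IsOpen A}) BorelSpace.measurable_eq isPiSystem_isOpen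
    (fun _ hA => (lowerSemicontinuous_fiberMeasure hP hA).measurable)
    (lowerSemicontinuous_fiberMeasure hP isOpen_univ).measurable

/-- The fibre measures as a kernel. -/
noncomputable def fiberKernel (P : Polynomial ℂ) (hP : P.natDegree ≠ 0) :
    ProbabilityTheory.Kernel ℂ ℂ := ⟨fiberMeasure P, measurable_fiberMeasure hP⟩

/-- The pull-back under `P` of the uniform probability measure on the unit circle, normalized by
the degree. -/
noncomputable def lemniscateMeasure (P : Polynomial ℂ) (hP : P.natDegree ≠ 0) : Measure ℂ :=
  (P.natDegree : ENNReal)⁻¹ • (circleMeasure 0 1).bind (fiberKernel P hP)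

theorem ae_circleMeasure_of_countable {s : Set ℂ} (hs : s.Countable) (c : ℂ) {r : ℝ}
    (hr : r ≠ 0) : ∀ᵐ z ∂(circleMeasure c r), z ∉ s := by
  rw [circleMeasure, ae_map_iff (measurable_circleMap' c r).aemeasurable hs.measurableSet.compl]
  refine Measure.ae_smul_measure (ae_restrict_of_ae ?_) _
  exact (hs.preimage_circleMap c hr).ae_notMem _

/-- Off the critical values, `P - ξ` has `deg P` simple roots. -/
theorem roots_nodup_ae {P : Polynomial ℂ} (hP : P.natDegree ≠ 0) :
    ∀ᵐ ξ ∂(circleMeasure 0 1), (P - Polynomial.C ξ).roots.Nodup := by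
  have hd : P.derivative ≠ 0 := by
    intro h
    exact hP (Polynomial.derivative_eq_zero.1 h)
  have hfin : (P.eval '' (P.derivative.rootSet ℂ)).Countable :=
    ((Polynomial.rootSet_finite _ _).image _).countable
  filter_upwards [ae_circleMeasure_of_countable hfin 0 one_ne_zero] with ξ hξ
  rw [Multiset.nodup_iff_count_le_one]
  intro ζ
  rw [Polynomial.count_roots]
  by_contra! hgt
  rw [Polynomial.one_lt_rootMultiplicity_iff_isRoot (sub_C_ne_zero hP ξ)] at hgt
  refine hξ ⟨ζ, ?_, ?_⟩
  · rw [Polynomial.mem_rootSet]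
    refine ⟨hd, ?_⟩
    simpa using hgt.2
  · simpa [sub_eq_zero] using hgt.1

theorem card_fiberFinset {P : Polynomial ℂ} {ξ : ℂ}
    (h : (P - Polynomial.C ξ).roots.Nodup) : (fiberFinset P ξ).card = P.natDegree := by
  rw [fiberFinset, Multiset.toFinset_card_of_nodup h,
    ← (IsAlgClosed.splits _).natDegree_eq_card_roots, Polynomial.natDegree_sub_C]

theorem sum_log_fiberFinset {P : Polynomial ℂ} (hP : P.Monic) (hN : P.natDegree ≠ 0) {ξ z : ℂ}
    (h : (P - Polynomial.C ξ).roots.Nodup) (hz : P.eval z ≠ ξ) :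
    ∑ ζ ∈ fiberFinset P ξ, Real.log ‖z - ζ‖ = Real.log ‖P.eval z - ξ‖ := by
  have hm : (P - Polynomial.C ξ).Monic := by
    refine hP.sub_of_left ?_
    refine (Polynomial.degree_C_le).trans_lt ?_
    rw [← Polynomial.natDegree_pos_iff_degree_pos]
    omega
  have he := (IsAlgClosed.splits (P - Polynomial.C ξ)).eval_eq_prod_roots_of_monic hm z
  have he' : P.eval z - ξ = ∏ ζ ∈ fiberFinset P ξ, (z - ζ) := by
    rw [fiberFinset, Finset.prod, Multiset.toFinset_val, h.dedup, ← he]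
    simp
  rw [he', norm_prod, Real.log_prod]
  intro ζ hζ
  rw [mem_fiberFinset hN] at hζ
  rw [norm_ne_zero_iff, sub_ne_zero]
  rintro rfl
  exact hz hζ

theorem integral_fiberMeasure (P : Polynomial ℂ) (ξ : ℂ) (f : ℂ → ℝ) :
    ∫ ζ, f ζ ∂(fiberMeasure P ξ) = ∑ ζ ∈ fiberFinset P ξ, f ζ := by
  rw [fiberMeasure, integral_finsetSum_measure fun ζ _ => integrable_dirac (by simp)]
  simp

theorem integrable_fiberMeasure (P : Polynomial ℂ) (ξ : ℂ) (f : ℂ → ℝ) :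
    Integrable f (fiberMeasure P ξ) := by
  rw [fiberMeasure, integrable_finsetSum_measure]
  exact fun ζ _ => integrable_dirac (by simp)

theorem ae_fiberMeasure_iff (P : Polynomial ℂ) (ξ : ℂ) (p : ℂ → Prop) :
    (∀ᵐ ζ ∂(fiberMeasure P ξ), p ζ) ↔ ∀ ζ ∈ fiberFinset P ξ, p ζ := by
  simp only [ae_iff, fiberMeasure, Measure.finsetSum_apply, Finset.sum_eq_zero_iff,
    Measure.dirac_apply]
  simp

theorem isProbabilityMeasure_lemniscateMeasure {P : Polynomial ℂ} (hN : P.natDegree ≠ 0) :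
    IsProbabilityMeasure (lemniscateMeasure P hN) := by
  classical
  refine ⟨?_⟩
  rw [lemniscateMeasure, Measure.smul_apply, Measure.bind_apply MeasurableSet.univ
    (fiberKernel P hN).measurable.aemeasurable]
  have : ∀ᵐ ξ ∂(circleMeasure 0 1), fiberKernel P hN ξ Set.univ = (P.natDegree : ENNReal) := by
    filter_upwards [roots_nodup_ae hN] with ξ hξ
    change fiberMeasure P ξ Set.univ = _
    rw [fiberMeasure_apply P ξ MeasurableSet.univ]
    simp [card_fiberFinset hξ]
  rw [lintegral_congr_ae this]
  simp only [lintegral_const, measure_univ, mul_one, smul_eq_mul]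
  exact ENNReal.inv_mul_cancel (by simpa using hN) (by simp)

theorem ae_lemniscateMeasure {P : Polynomial ℂ} (hN : P.natDegree ≠ 0) {p : ℂ → Prop}
    (hp : MeasurableSet {z | p z})
    (h : ∀ᵐ ξ ∂(circleMeasure 0 1), ∀ ζ, P.eval ζ = ξ → p ζ) :
    ∀ᵐ z ∂(lemniscateMeasure P hN), p z := by
  refine Measure.ae_smul_measure (Measure.ae_comp_of_ae_ae hp ?_) _
  filter_upwards [h] with ξ hξ
  exact (ae_fiberMeasure_iff P ξ p).2 fun ζ hζ => hξ ζ ((mem_fiberFinset hN).1 hζ)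

theorem lemniscateMeasure_ae_norm_eval {P : Polynomial ℂ} (hN : P.natDegree ≠ 0) :
    ∀ᵐ z ∂(lemniscateMeasure P hN), ‖P.eval z‖ = 1 := by
  refine ae_lemniscateMeasure hN
    (measurableSet_eq_fun (P.continuous.norm.measurable) measurable_const) ?_
  filter_upwards [ae_circleMeasure_mem_sphere 0 zero_le_one] with ξ hξ ζ hζ
  rw [hζ]; simpa using hξ

theorem lemniscateMeasure_singleton {P : Polynomial ℂ} (hN : P.natDegree ≠ 0) (z : ℂ) :
    lemniscateMeasure P hN {z} = 0 := by
  have : ∀ᵐ w ∂(lemniscateMeasure P hN), w ≠ z := by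
    refine ae_lemniscateMeasure hN (measurableSet_singleton z).compl ?_
    filter_upwards [ae_circleMeasure_of_countable (Set.countable_singleton (P.eval z)) 0
      one_ne_zero] with ξ hξ ζ hζ hζz
    exact hξ (by rw [← hζ, hζz]; rfl)
  simpa [ae_iff] using this

theorem isCompact_lemniscate {P : Polynomial ℂ} (hN : P.natDegree ≠ 0) :
    IsCompact {z | ‖P.eval z‖ ≤ 1} := by
  have hcl : IsClosed {z | ‖P.eval z‖ ≤ 1} := isClosed_le P.continuous.norm continuous_const
  have ht : Tendsto (fun z => ‖P.eval z‖) (cocompact ℂ) atTop :=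
    P.tendsto_norm_atTop (Polynomial.natDegree_pos_iff_degree_pos.1 (Nat.pos_of_ne_zero hN))
      tendsto_norm_cocompact_atTop
  obtain ⟨t, ht1, ht2⟩ := mem_cocompact.1 (ht.eventually_gt_atTop 1)
  refine ht1.of_isClosed_subset hcl fun z hz => ?_
  by_contra hzt
  have h1 : 1 < ‖P.eval z‖ := ht2 hzt
  have h2 : ‖P.eval z‖ ≤ 1 := hz
  linarith

theorem lemniscateMeasure_mem {P : Polynomial ℂ} (hN : P.natDegree ≠ 0) :
    lemniscateMeasure P hN ∈ probMeasuresOn {z | ‖P.eval z‖ ≤ 1} :=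
  ⟨isProbabilityMeasure_lemniscateMeasure hN,
    (lemniscateMeasure_ae_norm_eval hN).mono fun _ hz => le_of_eq hz⟩

theorem integrable_log_lemniscateMeasure {P : Polynomial ℂ} (hP : P.Monic)
    (hN : P.natDegree ≠ 0) (z : ℂ) :
    Integrable (fun w => Real.log ‖z - w‖) (lemniscateMeasure P hN) := by
  obtain ⟨R, hR⟩ := (isCompact_lemniscate hN).isBounded.exists_norm_le
  refine Integrable.smul_measure ?_ (by simpa using hN)
  rw [Measure.integrable_comp_iff (measurable_log_norm_const_sub z).aestronglyMeasurable]
  refine ⟨ae_of_all _ fun ξ => integrable_fiberMeasure P ξ _, ?_⟩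
  have hi := integrable_log_circleMeasure 0 1 (P.eval z)
  set C : ℝ := P.natDegree * (2 * (Real.log 2 + Real.posLog ‖z‖ + Real.posLog R))
  refine ((integrable_const C).sub hi).mono' ?_ ?_
  · exact ((measurable_log_norm_const_sub z).norm.stronglyMeasurable.integral_kernel
      (κ := fiberKernel P hN)).aestronglyMeasurable
  · filter_upwards [roots_nodup_ae hN, ae_circleMeasure_mem_sphere 0 zero_le_one,
      ae_circleMeasure_of_countable (Set.countable_singleton (P.eval z)) 0 one_ne_zero]
      with ξ h1 h2 h3
    change ‖∫ w, ‖Real.log ‖z - w‖‖ ∂(fiberMeasure P ξ)‖ ≤ C - Real.log ‖ξ - P.eval z‖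
    rw [Real.norm_of_nonneg (integral_nonneg fun _ => norm_nonneg _), integral_fiberMeasure,
      norm_sub_rev, ← sum_log_fiberFinset hP hN h1 (fun h => h3 h.symm)]
    simp only [Real.norm_eq_abs, abs_log_eq]
    rw [Finset.sum_sub_distrib]
    gcongr
    calc ∑ ζ ∈ fiberFinset P ξ, 2 * Real.posLog ‖z - ζ‖
        ≤ ∑ ζ ∈ fiberFinset P ξ, 2 * (Real.log 2 + Real.posLog ‖z‖ + Real.posLog R) := by
          refine Finset.sum_le_sum fun ζ hζ => ?_
          rw [mem_fiberFinset hN] at hζ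
          have h4 : ‖ζ‖ ≤ R := hR ζ (by
            rw [Set.mem_ofPred_eq, hζ]; exact le_of_eq (by simpa using h2))
          have h5 := Real.posLog_le_posLog (norm_nonneg _) h4
          linarith [posLog_norm_sub_le z ζ]
      _ = C := by rw [Finset.sum_const, card_fiberFinset h1, nsmul_eq_mul]

/-- Jensen's formula on the unit circle, averaged over the fibres. -/
theorem logIntegral_lemniscateMeasure {P : Polynomial ℂ} (hP : P.Monic) (hN : P.natDegree ≠ 0)
    (z : ℂ) : logIntegral (lemniscateMeasure P hN) z
      = (P.natDegree : ℝ)⁻¹ * Real.posLog ‖P.eval z‖ := by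
  have hi : Integrable (fun w => Real.log ‖z - w‖)
      ((circleMeasure 0 1).bind (fiberKernel P hN)) := by
    have := integrable_log_lemniscateMeasure hP hN z
    rwa [lemniscateMeasure, integrable_smul_measure (by simp) (by simpa using hN)] at this
  rw [logIntegral, lemniscateMeasure, integral_smul_measure]
  rw [Measure.comp_eq_comp_const_apply] at hi ⊢
  rw [ProbabilityTheory.Kernel.integral_comp hi]
  simp only [ProbabilityTheory.Kernel.const_apply, ENNReal.toReal_inv, ENNReal.toReal_natCast,
    smul_eq_mul]
  congr 1
  have h0 := integral_log_circleMeasure 0 zero_lt_one (P.eval z)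
  rw [zero_sub, norm_neg, ← Real.posLog_eq_log_max_one (norm_nonneg _)] at h0
  rw [← h0]
  refine integral_congr_ae ?_
  filter_upwards [roots_nodup_ae hN,
    ae_circleMeasure_of_countable (Set.countable_singleton (P.eval z)) 0 one_ne_zero] with ξ h1 h3
  change ∫ w, Real.log ‖z - w‖ ∂(fiberMeasure P ξ) = _
  rw [integral_fiberMeasure, sum_log_fiberFinset hP hN h1 (fun h => h3 h.symm), norm_sub_rev]

theorem logEnergy_lemniscateMeasure {P : Polynomial ℂ} (hP : P.Monic) (hN : P.natDegree ≠ 0) :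
    logEnergy (lemniscateMeasure P hN) = 0 := by
  have : ∀ᵐ z ∂(lemniscateMeasure P hN),
      logPotential (lemniscateMeasure P hN) z = ((0 : ℝ) : EReal) := by
    filter_upwards [lemniscateMeasure_ae_norm_eval hN] with z hz
    rw [logPotential_eq_coe (integrable_log_lemniscateMeasure hP hN z)
      (lemniscateMeasure_singleton hN z)]
    have h := logIntegral_lemniscateMeasure hP hN z
    rw [hz, Real.posLog_one, mul_zero] at h
    unfold logIntegral at h
    rw [h, neg_zero]
  rw [logEnergy, erealIntegral_eq_coe this (integrable_zero _ _ _)]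
  simp

/-! ### Lemniscates have capacity one -/

/-- Monic polynomials of all degrees which are uniformly bounded on `{|P| ≤ 1}`. -/
noncomputable def lemniscateBasis (P : Polynomial ℂ) (i : ℕ) : Polynomial ℂ :=
  P ^ (i / P.natDegree) * Polynomial.X ^ (i % P.natDegree)

theorem monic_lemniscateBasis {P : Polynomial ℂ} (hP : P.Monic) (i : ℕ) :
    (lemniscateBasis P i).Monic := (hP.pow _).mul (Polynomial.monic_X_pow _)

theorem natDegree_lemniscateBasis {P : Polynomial ℂ} (hP : P.Monic) (i : ℕ) :
    (lemniscateBasis P i).natDegree = i := by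
  rw [lemniscateBasis, (hP.pow _).natDegree_mul (Polynomial.monic_X_pow _), hP.natDegree_pow,
    Polynomial.natDegree_X_pow, Nat.div_add_mod']

theorem norm_eval_lemniscateBasis_le {P : Polynomial ℂ} (hN : P.natDegree ≠ 0) {z : ℂ} {R : ℝ}
    (hz : ‖P.eval z‖ ≤ 1) (hR : ‖z‖ ≤ R) (hR1 : 1 ≤ R) (i : ℕ) :
    ‖(lemniscateBasis P i).eval z‖ ≤ R ^ P.natDegree := by
  rw [lemniscateBasis, Polynomial.eval_mul, Polynomial.eval_pow, Polynomial.eval_pow,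
    Polynomial.eval_X, norm_mul, norm_pow, norm_pow]
  calc ‖P.eval z‖ ^ (i / P.natDegree) * ‖z‖ ^ (i % P.natDegree)
      ≤ 1 * R ^ (i % P.natDegree) := by
        gcongr
        exact pow_le_one₀ (norm_nonneg _) hz
    _ ≤ R ^ P.natDegree := by
        rw [one_mul]
        exact pow_le_pow_right₀ hR1 (Nat.mod_lt _ (Nat.pos_of_ne_zero hN)).le

/-- The logarithm of a Vandermonde determinant with nodes in a lemniscate, estimated after a change
of the monomial basis to `lemniscateBasis`. -/
theorem sum_log_norm_sub_le {P : Polynomial ℂ} (hP : P.Monic) (hN : P.natDegree ≠ 0) {R : ℝ}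
    (hR1 : 1 ≤ R) {M : ℕ} {v : Fin M → ℂ} (hv : Function.Injective v)
    (hK : ∀ i, ‖P.eval (v i)‖ ≤ 1 ∧ ‖v i‖ ≤ R) :
    ∑ i : Fin M, ∑ j ∈ Finset.Ioi i, Real.log ‖v j - v i‖
      ≤ M * (Real.log M + P.natDegree * Real.log R) := by
  have h1 : ∑ i : Fin M, ∑ j ∈ Finset.Ioi i, Real.log ‖v j - v i‖
      = Real.log ‖(Matrix.vandermonde v).det‖ := by
    have hne : ∀ i, ∀ j ∈ Finset.Ioi i, ‖v j - v i‖ ≠ 0 := fun i j hj => by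
      rw [norm_ne_zero_iff, sub_ne_zero]
      exact fun h => (Finset.mem_Ioi.1 hj).ne (hv h).symm
    rw [Matrix.det_vandermonde, norm_prod, Real.log_prod]
    · refine Finset.sum_congr rfl fun i _ => ?_
      rw [norm_prod, Real.log_prod (hne i)]
    · intro i _
      rw [norm_prod]
      exact Finset.prod_ne_zero_iff.2 (hne i)
  have h2 : ‖(Matrix.vandermonde v).det‖ ≤ (M ^ M : ℝ) * (R ^ P.natDegree) ^ M := by
    rw [Matrix.det_eval_matrixOfPolynomials_eq_det_vandermonde v
      (fun i => lemniscateBasis P i) (fun i => natDegree_lemniscateBasis hP i)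
      (fun i => monic_lemniscateBasis hP i)]
    refine (Matrix.det_le (abv := NormedField.toAbsoluteValue ℂ) (x := R ^ P.natDegree)
      fun i j => ?_).trans ?_
    · exact norm_eval_lemniscateBasis_le hN (hK i).1 (hK i).2 hR1 j
    · rw [Fintype.card_fin, nsmul_eq_mul]
      gcongr
      exact_mod_cast Nat.factorial_le_pow M
  rw [h1]
  have hpos : 0 < ‖(Matrix.vandermonde v).det‖ :=
    norm_pos_iff.2 (Matrix.det_vandermonde_ne_zero_iff.2 hv)
  rcases Nat.eq_zero_or_pos M with hM | hM
  · subst hM; simp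
  have hM' : (0 : ℝ) < M := by exact_mod_cast hM
  refine (Real.log_le_log hpos h2).trans (le_of_eq ?_)
  rw [Real.log_mul (by positivity) (by positivity), Real.log_pow, Real.log_pow, Real.log_pow]
  ring

theorem map_pi_pair {τ : Measure ℂ} [IsProbabilityMeasure τ] {M : ℕ} {i j : Fin M} (h : j ≠ i) :
    (Measure.pi fun _ : Fin M => τ).map (fun v => (v j, v i)) = τ.prod τ := by
  have hind := (ProbabilityTheory.iIndepFun_pi (μ := fun _ : Fin M => τ)
    (X := fun _ z => z) (fun _ => aemeasurable_id)).indepFun h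
  rw [ProbabilityTheory.indepFun_iff_map_prod_eq_prod_map_map
    (measurable_pi_apply j).aemeasurable (measurable_pi_apply i).aemeasurable] at hind
  rw [hind]
  have hm : ∀ k : Fin M, (Measure.pi fun _ : Fin M => τ).map (fun v => v k) = τ := fun k =>
    (measurePreserving_eval (fun _ : Fin M => τ) k).map_eq
  rw [hm, hm]

theorem sum_card_Ioi (M : ℕ) :
    (∑ i : Fin M, ((Finset.Ioi i).card : ℝ)) * 2 = M * (M - 1) := by
  simp only [Fin.card_Ioi]
  have h : (∑ i : Fin M, (M - 1 - (i : ℕ))) * 2 = M * (M - 1) := by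
    rw [Fin.sum_univ_eq_sum_range (fun i => M - 1 - i) M, Finset.sum_range_reflect (fun i => i) M,
      Finset.sum_range_id_mul_two]
  rcases Nat.eq_zero_or_pos M with hM | hM
  · subst hM; simp
  · have h' : ((∑ i : Fin M, (M - 1 - (i : ℕ)) : ℕ) : ℝ) * 2 = (M : ℝ) * ((M - 1 : ℕ) : ℝ) := by
      exact_mod_cast h
    rw [Nat.cast_sum] at h'
    rw [h', Nat.cast_pred hM]

/-- Measures on a lemniscate have nonnegative energy: for `M` independent points with law `τ`, the
expected logarithm of the Vandermonde determinant is `M (M - 1) / 2` times the logarithmic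
integral, while Vandermonde determinants on the lemniscate are at most `M! C ^ M`. -/
theorem logEnergy_nonneg_of_lemniscate {P : Polynomial ℂ} (hP : P.Monic) (hN : P.natDegree ≠ 0)
    {τ : Measure ℂ} (hτ : τ ∈ probMeasuresOn {z | ‖P.eval z‖ ≤ 1}) : 0 ≤ logEnergy τ := by
  have := hτ.1
  by_cases hT : logEnergy τ = ⊤
  · rw [hT]; exact le_top
  have hbd := (isCompact_lemniscate hN).isBounded
  obtain ⟨hi, hd⟩ := integrable_log_prod_of_logEnergy_ne_top hbd hτ hT
  have hd' := measure_singleton_eq_zero_of_ae hd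
  obtain ⟨R, hR⟩ := hbd.exists_norm_le
  set D := ∫ p, Real.log ‖p.1 - p.2‖ ∂(τ.prod τ) with hD
  rw [logEnergy_eq_coe hi hd]
  suffices hD0 : D ≤ 0 by
    have : (0 : ℝ) ≤ -D := by linarith
    exact_mod_cast this
  have hdiag : ∀ᵐ p ∂(τ.prod τ), p.1 ≠ p.2 := by
    rw [Measure.ae_prod_iff_ae_ae]
    · refine ae_of_all _ fun z => ?_
      have : ∀ᵐ w ∂τ, w ≠ z := by simpa [ae_iff] using hd' z
      exact this.mono fun w hw => hw.symm
    · exact (measurableSet_eq_fun measurable_fst measurable_snd).compl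
  set c := (P.natDegree : ℝ) * Real.log (max 1 R) with hc
  have key : ∀ M : ℕ, 2 ≤ M → D ≤ 2 * (Real.log M / (M - 1)) + 2 * c * (1 / (M - 1)) := by
    intro M hM
    have hM' : (2 : ℝ) ≤ M := by exact_mod_cast hM
    set Q : Measure (Fin M → ℂ) := Measure.pi fun _ => τ with hQ
    have hmeas : ∀ i j : Fin M, Measurable fun v : Fin M → ℂ => (v j, v i) := fun i j => by fun_prop
    have hint : ∀ i : Fin M, ∀ j ∈ Finset.Ioi i, Integrable (fun v => Real.log ‖v j - v i‖) Q := by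
      intro i j hj
      have h1 : Integrable (fun p : ℂ × ℂ => Real.log ‖p.1 - p.2‖)
          (Q.map fun v => (v j, v i)) := by
        rw [hQ, map_pi_pair (Finset.mem_Ioi.1 hj).ne']; exact hi
      exact h1.comp_measurable (hmeas i j)
    have hval : ∀ i : Fin M, ∀ j ∈ Finset.Ioi i, ∫ v, Real.log ‖v j - v i‖ ∂Q = D := by
      intro i j hj
      rw [hD, ← map_pi_pair (Finset.mem_Ioi.1 hj).ne', integral_map (hmeas i j).aemeasurable
        measurable_log_norm_sub.aestronglyMeasurable]
    have hinj : ∀ᵐ v ∂Q, Function.Injective v := by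
      have h1 : ∀ i j : Fin M, j ≠ i → ∀ᵐ v ∂Q, v j ≠ v i := by
        intro i j hj
        have h2 := hdiag
        rw [← map_pi_pair hj] at h2
        exact ae_of_ae_map (hmeas i j).aemeasurable h2
      have h3 : ∀ᵐ v ∂Q, ∀ i j : Fin M, j ≠ i → v j ≠ v i := by
        simp only [eventually_all]
        exact h1
      filter_upwards [h3] with v hv i j hij
      by_contra hne
      exact hv j i hne hij
    have hmem : ∀ᵐ v ∂Q, ∀ i, ‖P.eval (v i)‖ ≤ 1 ∧ ‖v i‖ ≤ max 1 R := by
      simp only [eventually_all]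
      intro i
      have h1 : ∀ᵐ z ∂τ, ‖P.eval z‖ ≤ 1 := hτ.2
      filter_upwards [(measurePreserving_eval (fun _ : Fin M => τ) i).quasiMeasurePreserving.ae h1]
        with v hv
      exact ⟨hv, (hR _ hv).trans (le_max_right _ _)⟩
    have hle : ∫ v, ∑ i : Fin M, ∑ j ∈ Finset.Ioi i, Real.log ‖v j - v i‖ ∂Q
        ≤ ∫ _, (M * (Real.log M + c) : ℝ) ∂Q := by
      refine integral_mono_ae (integrable_finsetSum _ fun i _ =>
        integrable_finsetSum _ fun j hj => hint i j hj) (integrable_const _) ?_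
      filter_upwards [hinj, hmem] with v h1 h2
      exact sum_log_norm_sub_le hP hN (le_max_left _ _) h1 h2
    rw [integral_finsetSum _ fun i _ => integrable_finsetSum _ fun j hj => hint i j hj] at hle
    have hsum : ∀ i : Fin M, ∫ v, ∑ j ∈ Finset.Ioi i, Real.log ‖v j - v i‖ ∂Q
        = ((Finset.Ioi i).card : ℝ) * D := by
      intro i
      rw [integral_finsetSum _ fun j hj => hint i j hj, Finset.sum_congr rfl (hval i),
        Finset.sum_const, nsmul_eq_mul]
    simp only [hsum] at hle
    rw [← Finset.sum_mul] at hle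
    simp only [integral_const, probReal_univ, smul_eq_mul, one_mul] at hle
    have hcard := sum_card_Ioi M
    have h4 : (M : ℝ) * ((M - 1) * D) ≤ M * (2 * (Real.log M + c)) := by
      calc (M : ℝ) * ((M - 1) * D) = (M * (M - 1)) * D := by ring
        _ = 2 * ((∑ i : Fin M, ((Finset.Ioi i).card : ℝ)) * D) := by rw [← hcard]; ring
        _ ≤ M * (2 * (Real.log M + c)) := by linarith
    have h5 := le_of_mul_le_mul_left h4 (by linarith)
    have h6 : D ≤ (2 * (Real.log M + c)) / (M - 1) := by
      rw [le_div_iff₀ (by linarith)]; linarith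
    refine h6.trans (le_of_eq ?_)
    ring
  have ht0 := (Real.tendsto_pow_log_div_mul_add_atTop 1 (-1) 0 one_ne_zero).comp
    tendsto_natCast_atTop_atTop
  have ht1 := (Real.tendsto_pow_log_div_mul_add_atTop 1 (-1) 1 one_ne_zero).comp
    tendsto_natCast_atTop_atTop
  have ht := (ht1.const_mul 2).add (ht0.const_mul (2 * c))
  rw [mul_zero, mul_zero, add_zero] at ht
  refine ge_of_tendsto ht ?_
  filter_upwards [eventually_ge_atTop 2] with M hM
  refine (key M hM).trans (le_of_eq ?_)
  simp [sub_eq_add_neg]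

theorem lemniscate_isEquilibriumMeasure {P : Polynomial ℂ} (hP : P.Monic) (hN : P.natDegree ≠ 0) :
    IsCompact {z | ‖P.eval z‖ ≤ 1} ∧ logCapacity {z | ‖P.eval z‖ ≤ 1} = 1 ∧
      IsEquilibriumMeasure {z | ‖P.eval z‖ ≤ 1} (lemniscateMeasure P hN) := by
  have h0 := logEnergy_lemniscateMeasure hP hN
  have hm := lemniscateMeasure_mem hN
  refine ⟨isCompact_lemniscate hN, ?_, ?_, hm, ?_⟩
  · have hinf : ⨅ τ ∈ probMeasuresOn {z | ‖P.eval z‖ ≤ 1}, logEnergy τ = 0 :=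
      le_antisymm ((iInf₂_le _ hm).trans h0.le)
        (le_iInf₂ fun τ hτ => logEnergy_nonneg_of_lemniscate hP hN hτ)
    rw [logCapacity, hinf, neg_zero, EReal.exp_zero]
  · intro h
    have := h _ hm
    rw [h0] at this
    exact EReal.zero_ne_top this
  · intro τ hτ
    rw [h0]
    exact logEnergy_nonneg_of_lemniscate hP hN hτ

/-! ### A criterion for log-weak convergence -/

theorem lintegral_circleMeasure_eq_translate {H : ℂ → ENNReal} (hH : Measurable H) (a : ℂ)
    (s : ℝ) : ∫⁻ z, H z ∂(circleMeasure a s) = ∫⁻ z, H (a + z) ∂(circleMeasure 0 s) := by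
  have hH' : Measurable fun z => H (a + z) := hH.comp (measurable_const_add a)
  rw [circleMeasure, circleMeasure, lintegral_map hH (measurable_circleMap' a s),
    lintegral_map hH' (measurable_circleMap' 0 s)]
  simp [circleMap]

theorem measurable_lintegral_circleMeasure {H : ℂ → ENNReal} (hH : Measurable H) (s : ℝ) :
    Measurable fun a => ∫⁻ z, H z ∂(circleMeasure a s) := by
  simp only [lintegral_circleMeasure_eq_translate hH]
  exact Measurable.lintegral_prod_right' (f := fun p : ℂ × ℂ => H (p.1 + p.2))
    (hH.comp measurable_add)

/-- The integral of `H` over the circles of radius `s` centred in a disc is controlled by its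
integral over a larger disc. -/
theorem setLIntegral_lintegral_circleMeasure_le {H : ℂ → ENNReal} (hH : Measurable H) (R : ℝ)
    {s : ℝ} (hs : 0 ≤ s) :
    ∫⁻ a in Metric.ball 0 R, ∫⁻ z, H z ∂(circleMeasure a s) ≤ ∫⁻ z in Metric.ball 0 (R + s), H z := by
  simp only [lintegral_circleMeasure_eq_translate hH]
  rw [lintegral_lintegral_swap (by fun_prop)]
  calc _ ≤ ∫⁻ z, (∫⁻ x in Metric.ball 0 (R + s), H x) ∂(circleMeasure 0 s) := by
        refine lintegral_mono_ae ?_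
        filter_upwards [ae_circleMeasure_mem_sphere 0 hs] with z hz
        rw [← lintegral_indicator measurableSet_ball, ← lintegral_indicator measurableSet_ball,
          ← lintegral_add_right_eq_self ((Metric.ball (0 : ℂ) (R + s)).indicator H) z]
        refine lintegral_mono fun a => ?_
        by_cases ha : a ∈ Metric.ball (0 : ℂ) R
        · have : a + z ∈ Metric.ball (0 : ℂ) (R + s) := by
            rw [mem_ball_zero_iff] at ha ⊢
            rw [sub_zero] at hz
            exact (norm_add_le _ _).trans_lt (by linarith)
          simp [ha, this]
        · simp [ha]
    _ = ∫⁻ z in Metric.ball 0 (R + s), H z := by simp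

/-- A compactly supported radial bump around `a`, the difference of two logarithmic potentials of
circles. -/
noncomputable def logBump (r : ℝ) (a w : ℂ) : ℝ :=
  Real.log (max (2 * r) ‖a - w‖) - Real.log (max r ‖a - w‖)

theorem logBump_nonneg {r : ℝ} (hr : 0 < r) (a w : ℂ) : 0 ≤ logBump r a w := by
  refine sub_nonneg.2 (Real.log_le_log (hr.trans_le (le_max_left _ _)) ?_)
  gcongr; linarith

theorem logBump_le {r : ℝ} (hr : 0 < r) (a w : ℂ) : logBump r a w ≤ Real.log 2 := by
  rw [logBump, sub_le_iff_le_add, ← Real.log_mul two_ne_zero (hr.trans_le (le_max_left _ _)).ne']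
  refine Real.log_le_log ((mul_pos two_pos hr).trans_le (le_max_left _ _)) (max_le ?_ ?_)
  · gcongr; exact le_max_left _ _
  · linarith [le_max_right r ‖a - w‖, le_max_left r ‖a - w‖]

theorem logBump_eq_zero {r : ℝ} (hr : 0 < r) {a w : ℂ} (h : 2 * r ≤ ‖a - w‖) :
    logBump r a w = 0 := by
  rw [logBump, max_eq_right h, max_eq_right (by linarith), sub_self]

theorem continuous_logBump {r : ℝ} (hr : 0 < r) :
    Continuous fun p : ℂ × ℂ => logBump r p.1 p.2 := by
  unfold logBump
  refine Continuous.sub ?_ ?_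
  · exact Continuous.log (by fun_prop) fun p => ((mul_pos two_pos hr).trans_le (le_max_left _ _)).ne'
  · exact Continuous.log (by fun_prop) fun p => (hr.trans_le (le_max_left _ _)).ne'

theorem logBump_sub (r : ℝ) (a w : ℂ) : logBump r a w = logBump r (a - w) 0 := by
  simp [logBump]

theorem hasCompactSupport_logBump {r : ℝ} (hr : 0 < r) :
    HasCompactSupport fun a => logBump r a 0 := by
  refine HasCompactSupport.intro (isCompact_closedBall 0 (2 * r)) fun a ha => ?_
  refine logBump_eq_zero hr ?_
  rw [mem_closedBall_zero_iff, not_le] at ha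
  simpa using ha.le

theorem integral_logBump_pos {r : ℝ} (hr : 0 < r) : 0 < ∫ a, logBump r a 0 := by
  have hc : Continuous fun a => logBump r a 0 :=
    (continuous_logBump hr).comp (continuous_id.prodMk continuous_const)
  refine hc.integral_pos_of_hasCompactSupport_nonneg_nonzero (hasCompactSupport_logBump hr)
    (fun a => logBump_nonneg hr a 0) (x := 0) ?_
  have h : logBump r 0 0 = Real.log 2 := by
    rw [logBump, sub_zero, norm_zero, max_eq_left (by linarith), max_eq_left hr.le,
      Real.log_mul two_ne_zero hr.ne']
    ring
  rw [h]
  exact (Real.log_pos one_lt_two).ne'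

theorem integrable_logBump {r : ℝ} (hr : 0 < r) (w : ℂ) : Integrable fun a => logBump r a w := by
  have hc : Continuous fun a => logBump r a 0 :=
    (continuous_logBump hr).comp (continuous_id.prodMk continuous_const)
  have := (hc.integrable_of_hasCompactSupport (μ := volume)
    (hasCompactSupport_logBump hr)).comp_sub_right w
  simpa only [← logBump_sub] using this

theorem integral_logBump_eq {r : ℝ} (w : ℂ) :
    ∫ a, logBump r a w = ∫ a, logBump r a 0 := by
  rw [← integral_sub_right_eq_self (fun a => logBump r a 0) w]
  simp only [← logBump_sub]

theorem integral_logBump_eq_circle {τ : Measure ℂ} [IsFiniteMeasure τ]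
    (hτ : Integrable (fun w : ℂ => Real.posLog ‖w‖) τ) {r : ℝ} (hr : 0 < r) (a : ℂ) :
    ∫ w, logBump r a w ∂τ = ∫ z, logIntegral τ z ∂(circleMeasure a (2 * r))
      - ∫ z, logIntegral τ z ∂(circleMeasure a r) := by
  rw [integral_logIntegral_circleMeasure hτ a (by positivity),
    integral_logIntegral_circleMeasure hτ a hr]
  exact integral_sub (integrable_log_max hτ (by positivity) a) (integrable_log_max hτ hr a)

theorem integrable_mul_logBump_prod {f : ℂ → ℝ} (hf : Integrable f) {τ : Measure ℂ}
    [IsFiniteMeasure τ] {r : ℝ} (hr : 0 < r) :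
    Integrable (fun p : ℂ × ℂ => f p.1 * logBump r p.1 p.2) (volume.prod τ) := by
  have h1 : Integrable (fun p : ℂ × ℂ => f p.1) (volume.prod τ) := hf.comp_fst τ
  refine h1.mul_bdd (c := Real.log 2) (continuous_logBump hr).aestronglyMeasurable
    (ae_of_all _ fun p => ?_)
  rw [Real.norm_of_nonneg (logBump_nonneg hr _ _)]
  exact logBump_le hr _ _

/-- Mollification of a uniformly continuous function by the bumps. -/
theorem abs_integral_mul_logBump_sub_le {f : ℂ → ℝ} (hf : Integrable f) {r ε : ℝ}
    (hr : 0 < r) (w : ℂ) (h : ∀ a, ‖a - w‖ < 2 * r → |f a - f w| ≤ ε) :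
    |(∫ a, f a * logBump r a w) - (∫ a, logBump r a 0) * f w| ≤ ε * ∫ a, logBump r a 0 := by
  have hb := integrable_logBump hr w
  have hfb : Integrable fun a => f a * logBump r a w := by
    refine hf.mul_bdd (c := Real.log 2) hb.1 (ae_of_all _ fun p => ?_)
    rw [Real.norm_of_nonneg (logBump_nonneg hr _ _)]
    exact logBump_le hr _ _
  rw [← integral_logBump_eq w, ← integral_mul_const, ← integral_const_mul,
    ← integral_sub hfb (hb.mul_const _)]
  rw [← Real.norm_eq_abs]
  refine norm_integral_le_of_norm_le (hb.const_mul ε) (ae_of_all _ fun a => ?_)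
  rw [Real.norm_eq_abs, mul_comm (logBump r a w), ← sub_mul, abs_mul,
    abs_of_nonneg (logBump_nonneg hr a w)]
  by_cases ha : ‖a - w‖ < 2 * r
  · exact mul_le_mul_of_nonneg_right (h a ha) (logBump_nonneg hr a w)
  · rw [logBump_eq_zero hr (not_lt.1 ha)]; simp

/-- Convergence in `L¹` on discs passes to averages over circles with moving centres. -/
theorem tendsto_integral_mul_logBump {μ : Measure ℂ} {ω : ℕ → Measure ℂ} (hμ : MemPLog μ)
    (hω : ∀ n, MemPLog (ω n))
    (hloc : ∀ R : ℝ, Tendsto (fun n => ∫⁻ z in Metric.ball 0 R,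
      ‖logIntegral (ω n) z - logIntegral μ z‖ₑ) atTop (𝓝 0))
    {f : ℂ → ℝ} (hf : Continuous f) (hfc : HasCompactSupport f) {r : ℝ} (hr : 0 < r) :
    Tendsto (fun n => ∫ a, f a * ∫ w, logBump r a w ∂(ω n)) atTop
      (𝓝 (∫ a, f a * ∫ w, logBump r a w ∂μ)) := by
  have := hμ.1
  have := fun n => (hω n).1
  have hfi : Integrable f := hf.integrable_of_hasCompactSupport hfc
  obtain ⟨C, hC⟩ := hfc.exists_bound_of_continuous hf
  obtain ⟨R, hR⟩ := hfc.isCompact.isBounded.subset_ball 0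
  have hint : ∀ τ : Measure ℂ, IsFiniteMeasure τ →
      Integrable fun a => f a * ∫ w, logBump r a w ∂τ := by
    intro τ _
    have := (integrable_mul_logBump_prod hfi (τ := τ) hr).integral_prod_left
    simpa only [integral_const_mul] using this
  refine tendsto_integral_of_L1 _ (hint μ inferInstance).1
    (Eventually.of_forall fun n => hint (ω n) inferInstance) ?_
  set H : ℕ → ℂ → ENNReal := fun n z => ‖logIntegral (ω n) z - logIntegral μ z‖ₑ with hH
  have hHm : ∀ n, Measurable (H n) := fun n =>
    ((measurable_logIntegral (ω n)).sub (measurable_logIntegral μ)).enorm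
  have hbound : ∀ n, ∫⁻ a, ‖f a * ∫ w, logBump r a w ∂(ω n) - f a * ∫ w, logBump r a w ∂μ‖ₑ
      ≤ ENNReal.ofReal C * ((∫⁻ z in Metric.ball 0 (R + 2 * r), H n z)
        + ∫⁻ z in Metric.ball 0 (R + r), H n z) := by
    intro n
    have hpt : ∀ a, ‖f a * ∫ w, logBump r a w ∂(ω n) - f a * ∫ w, logBump r a w ∂μ‖ₑ ≤
        (Metric.ball (0 : ℂ) R).indicator (fun a => ENNReal.ofReal C *
          (∫⁻ z, H n z ∂(circleMeasure a (2 * r)) + ∫⁻ z, H n z ∂(circleMeasure a r))) a := by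
      intro a
      by_cases ha : a ∈ Metric.ball (0 : ℂ) R
      · rw [Set.indicator_of_mem ha, ← mul_sub, enorm_mul]
        refine mul_le_mul' ?_ ?_
        · rw [← ofReal_norm]
          exact ENNReal.ofReal_le_ofReal (hC a)
        · rw [integral_logBump_eq_circle (hω n).2 hr, integral_logBump_eq_circle hμ.2 hr,
            sub_sub_sub_comm]
          have hs : (0 : ℝ) < 2 * r := by positivity
          rw [← integral_sub (integrable_logIntegral_circleMeasure (hω n).2 a hs)
            (integrable_logIntegral_circleMeasure hμ.2 a hs),
            ← integral_sub (integrable_logIntegral_circleMeasure (hω n).2 a hr)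
            (integrable_logIntegral_circleMeasure hμ.2 a hr)]
          exact enorm_sub_le.trans (add_le_add (enorm_integral_le_lintegral_enorm _)
            (enorm_integral_le_lintegral_enorm _))
      · have h0 : f a = 0 := image_eq_zero_of_notMem_tsupport fun h => ha (hR h)
        simp [h0]
    have hmeas := measurable_lintegral_circleMeasure (hHm n)
    refine (lintegral_mono hpt).trans ?_
    rw [lintegral_indicator measurableSet_ball,
      lintegral_const_mul _ (by exact (hmeas _).add (hmeas _)),
      lintegral_add_left (hmeas _)]
    refine mul_le_mul' le_rfl (add_le_add ?_ ?_)
    · exact setLIntegral_lintegral_circleMeasure_le (hHm n) R (by positivity)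
    · exact setLIntegral_lintegral_circleMeasure_le (hHm n) R hr.le
  have hlim := ENNReal.Tendsto.const_mul (a := ENNReal.ofReal C)
    ((hloc (R + 2 * r)).add (hloc (R + r))) (Or.inr ENNReal.ofReal_ne_top)
  rw [add_zero, mul_zero] at hlim
  exact tendsto_of_tendsto_of_tendsto_of_le_of_le tendsto_const_nhds hlim
    (fun _ => zero_le) hbound

/-- Test functions are replaced by their mollifications by the bumps, which are integrals of
potentials. -/
theorem tendsto_integral_of_hasCompactSupport {μ : Measure ℂ} {ω : ℕ → Measure ℂ}
    (hμ : MemPLog μ) (hω : ∀ n, MemPLog (ω n))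
    (hloc : ∀ R : ℝ, Tendsto (fun n => ∫⁻ z in Metric.ball 0 R,
      ‖logIntegral (ω n) z - logIntegral μ z‖ₑ) atTop (𝓝 0))
    {f : ℂ → ℝ} (hf : Continuous f) (hfc : HasCompactSupport f) :
    Tendsto (fun n => ∫ z, f z ∂(ω n)) atTop (𝓝 (∫ z, f z ∂μ)) := by
  have := hμ.1
  have := fun n => (hω n).1
  have hfi : Integrable f := hf.integrable_of_hasCompactSupport hfc
  obtain ⟨C, hC⟩ := hfc.exists_bound_of_continuous hf
  rw [Metric.tendsto_nhds]
  intro ε hε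
  obtain ⟨δ, hδ, hfδ⟩ := Metric.uniformContinuous_iff.1
    (hfc.uniformContinuous_of_continuous hf) (ε / 4) (by positivity)
  set r := δ / 2 with hr'
  have hr : 0 < r := half_pos hδ
  set c := ∫ a, logBump r a 0 with hc'
  have hc : 0 < c := integral_logBump_pos hr
  -- the mollified function, integrated against any probability measure
  have happ : ∀ τ : Measure ℂ, IsProbabilityMeasure τ →
      |(∫ a, f a * ∫ w, logBump r a w ∂τ) - c * ∫ z, f z ∂τ| ≤ ε / 4 * c := by
    intro τ _
    have hp := integrable_mul_logBump_prod hfi (τ := τ) hr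
    have hfτ : Integrable f τ :=
      (integrable_const C).mono' hf.aestronglyMeasurable (ae_of_all _ hC)
    have hsw : ∫ a, f a * ∫ w, logBump r a w ∂τ = ∫ w, (∫ a, f a * logBump r a w) ∂τ := by
      refine Eq.trans ?_ (integral_integral_swap (f := fun a w => f a * logBump r a w) hp)
      simp only [integral_const_mul]
    have hsub := integral_sub (f := fun w => ∫ a, f a * logBump r a w) (g := fun w => c * f w)
      hp.integral_prod_right (hfτ.const_mul c)
    rw [hsw, ← integral_const_mul, ← hsub]
    have := norm_integral_le_of_norm_le_const (μ := τ) (C := ε / 4 * c)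
      (f := fun w => (∫ a, f a * logBump r a w) - c * f w) (ae_of_all _ fun w => ?_)
    · simpa using this
    · refine abs_integral_mul_logBump_sub_le hfi hr w fun a ha => ?_
      have := hfδ (a := a) (b := w) (by rw [dist_eq_norm]; rw [hr'] at ha; linarith)
      exact this.le
  have ht := (Metric.tendsto_nhds.1 (tendsto_integral_mul_logBump hμ hω hloc hf hfc hr))
    (ε / 4 * c) (by positivity)
  filter_upwards [ht] with n hn
  rw [Real.dist_eq] at hn ⊢
  have h1 := happ (ω n) inferInstance
  have h2 := happ μ inferInstance
  have h3 : |c * (∫ z, f z ∂(ω n) - ∫ z, f z ∂μ)| < c * ε := by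
    rw [abs_le] at h1 h2
    rw [abs_lt] at hn ⊢
    have := mul_pos hc hε
    constructor <;> nlinarith
  rw [abs_mul, abs_of_pos hc] at h3
  exact lt_of_mul_lt_mul_left h3 hc.le

/-- Vague convergence together with convergence of the integrals of `log⁺` is log-weak
convergence. -/
theorem logWeakTendsto_of_vague {μ : Measure ℂ} {ω : ℕ → Measure ℂ} (hμ : MemPLog μ)
    (hω : ∀ n, MemPLog (ω n))
    (hlog : Tendsto (fun n => ∫ z, Real.posLog ‖z‖ ∂(ω n)) atTop (𝓝 (∫ z, Real.posLog ‖z‖ ∂μ)))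
    (hv : ∀ f : ℂ → ℝ, Continuous f → HasCompactSupport f →
      Tendsto (fun n => ∫ z, f z ∂(ω n)) atTop (𝓝 (∫ z, f z ∂μ))) :
    LogWeakTendsto ω μ := by
  have := hμ.1
  have := fun n => (hω n).1
  refine ⟨hω, hμ, fun f hf hg => ?_⟩
  obtain ⟨A, B, hAB⟩ := hg
  set ψ : ℂ → ℝ := fun z => |A| + |B| * Real.posLog ‖z‖ with hψ
  have hψc : Continuous ψ := by fun_prop
  have hfψ : ∀ z, |f z| ≤ ψ z := fun z => (hAB z).trans
    (add_le_add (le_abs_self A) (mul_le_mul_of_nonneg_right (le_abs_self B) Real.posLog_nonneg))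
  have hψ0 : ∀ z, 0 ≤ ψ z := fun z => (abs_nonneg _).trans (hfψ z)
  have hψi : ∀ τ, MemPLog τ → Integrable ψ τ := fun τ hτ => by
    have := hτ.1
    exact (integrable_const _).add (hτ.2.const_mul _)
  have hψt : Tendsto (fun n => ∫ z, ψ z ∂(ω n)) atTop (𝓝 (∫ z, ψ z ∂μ)) := by
    have h1 : ∀ τ, MemPLog τ → ∫ z, ψ z ∂τ = |A| + |B| * ∫ z, Real.posLog ‖z‖ ∂τ := by
      intro τ hτ
      have := hτ.1
      rw [hψ, integral_add (integrable_const _) (hτ.2.const_mul _), integral_const_mul]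
      simp
    simp only [h1 _ (hω _), h1 _ hμ]
    exact (hlog.const_mul _).const_add _
  -- cut-off functions
  let χ : ℕ → ℂ → ℝ := fun k z => max 0 (min 1 (k + 1 - ‖z‖))
  have hχc : ∀ k, Continuous (χ k) := fun k => by fun_prop
  have hχs : ∀ k, HasCompactSupport (χ k) := fun k => by
    refine HasCompactSupport.intro (isCompact_closedBall 0 ((k : ℝ) + 1)) fun z hz => ?_
    rw [mem_closedBall_zero_iff, not_le] at hz
    exact max_eq_left ((min_le_right _ _).trans (by linarith))
  have hχ0 : ∀ k z, 0 ≤ χ k z := fun k z => le_max_left _ _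
  have hχ1 : ∀ k z, χ k z ≤ 1 := fun k z => max_le zero_le_one (min_le_left _ _)
  have htail : Tendsto (fun k => ∫ z, (1 - χ k z) * ψ z ∂μ) atTop (𝓝 (∫ _, (0 : ℝ) ∂μ)) := by
    refine tendsto_integral_of_dominated_convergence ψ (fun k => ?_) (hψi μ hμ) (fun k => ?_) ?_
    · exact (by fun_prop : Continuous fun z => (1 - χ k z) * ψ z).aestronglyMeasurable
    · refine ae_of_all _ fun z => ?_
      rw [Real.norm_of_nonneg (mul_nonneg (by linarith [hχ1 k z]) (hψ0 z))]
      nlinarith [hχ0 k z, hψ0 z]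
    · refine ae_of_all _ fun z => tendsto_const_nhds.congr' ?_
      filter_upwards [eventually_ge_atTop ⌈‖z‖⌉₊] with k hk
      have h1 : ‖z‖ ≤ k := (Nat.le_ceil _).trans (by exact_mod_cast hk)
      have h2 : χ k z = 1 := by
        change max 0 (min 1 ((k : ℝ) + 1 - ‖z‖)) = 1
        rw [min_eq_left (by linarith), max_eq_right zero_le_one]
      rw [h2]; ring
  rw [integral_zero] at htail
  rw [Metric.tendsto_nhds]
  intro ε hε
  obtain ⟨k, hk⟩ := (htail.eventually_lt_const (show (0 : ℝ) < ε / 4 by positivity)).exists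
  have hsplit : ∀ τ, MemPLog τ → |∫ z, f z ∂τ - ∫ z, χ k z * f z ∂τ| ≤
      ∫ z, ψ z ∂τ - ∫ z, χ k z * ψ z ∂τ := by
    intro τ hτ
    have := hτ.1
    have hfi : Integrable f τ := (hψi τ hτ).mono' hf.aestronglyMeasurable (ae_of_all _ hfψ)
    have hm : ∀ g : ℂ → ℝ, Integrable g τ → Integrable (fun z => χ k z * g z) τ := fun g hg =>
      hg.bdd_mul (c := 1) (hχc k).aestronglyMeasurable (ae_of_all _ fun z => by
        rw [Real.norm_of_nonneg (hχ0 k z)]; exact hχ1 k z)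
    rw [← integral_sub hfi (hm f hfi), ← integral_sub (hψi τ hτ) (hm ψ (hψi τ hτ))]
    rw [← Real.norm_eq_abs]
    refine norm_integral_le_of_norm_le ((hψi τ hτ).sub (hm ψ (hψi τ hτ)))
      (ae_of_all _ fun z => ?_)
    have h1 : f z - χ k z * f z = (1 - χ k z) * f z := by ring
    have h2 : ψ z - χ k z * ψ z = (1 - χ k z) * ψ z := by ring
    have h3 : 0 ≤ 1 - χ k z := by linarith [hχ1 k z]
    rw [h1, h2, Real.norm_eq_abs, abs_mul, abs_of_nonneg h3]
    exact mul_le_mul_of_nonneg_left (hfψ z) h3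
  have hμt : ∫ z, ψ z ∂μ - ∫ z, χ k z * ψ z ∂μ < ε / 4 := by
    rw [← integral_sub (hψi μ hμ)]
    · refine lt_of_eq_of_lt (integral_congr_ae (ae_of_all _ fun z => ?_)) hk
      simp only; ring
    · exact (hψi μ hμ).bdd_mul (c := 1) (hχc k).aestronglyMeasurable (ae_of_all _ fun z => by
        rw [Real.norm_of_nonneg (hχ0 k z)]; exact hχ1 k z)
  have ht1 := hψt.sub (hv (fun z => χ k z * ψ z) ((hχc k).mul hψc) (hχs k).mul_right)
  have ht2 := Metric.tendsto_nhds.1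
    (hv (fun z => χ k z * f z) ((hχc k).mul hf) (hχs k).mul_right) (ε / 4) (by positivity)
  filter_upwards [ht1.eventually_lt_const hμt, ht2] with n h1 h2
  rw [Real.dist_eq] at h2 ⊢
  have h3 := hsplit _ (hω n)
  have h4 := hsplit _ hμ
  rw [abs_le] at h3 h4
  rw [abs_lt] at h2 ⊢
  constructor <;> linarith

/-- Convergence of the potentials in `L¹` on discs and on the unit circle implies log-weak
convergence of the measures. -/
theorem logWeakTendsto_of_logIntegral {μ : Measure ℂ} {ω : ℕ → Measure ℂ} (hμ : MemPLog μ)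
    (hω : ∀ n, MemPLog (ω n))
    (hloc : ∀ R : ℝ, Tendsto (fun n => ∫⁻ z in Metric.ball 0 R,
      ‖logIntegral (ω n) z - logIntegral μ z‖ₑ) atTop (𝓝 0))
    (hcirc : Tendsto (fun n => ∫⁻ z, ‖logIntegral (ω n) z - logIntegral μ z‖ₑ
      ∂(circleMeasure 0 1)) atTop (𝓝 0)) : LogWeakTendsto ω μ := by
  have := hμ.1
  have := fun n => (hω n).1
  refine logWeakTendsto_of_vague hμ hω ?_ fun f hf hfc =>
    tendsto_integral_of_hasCompactSupport hμ hω hloc hf hfc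
  have h1 : ∀ τ, MemPLog τ →
      ∫ z, Real.posLog ‖z‖ ∂τ = ∫ z, logIntegral τ z ∂(circleMeasure 0 1) := by
    intro τ hτ
    have := hτ.1
    rw [integral_logIntegral_circleMeasure hτ.2 0 zero_lt_one]
    simp only [zero_sub, norm_neg, ← Real.posLog_eq_log_max_one (norm_nonneg _)]
  simp only [h1 _ (hω _), h1 _ hμ]
  exact tendsto_integral_of_L1 _
    (integrable_logIntegral_circleMeasure hμ.2 0 zero_lt_one).1
    (Eventually.of_forall fun n =>
      integrable_logIntegral_circleMeasure (hω n).2 0 zero_lt_one) hcirc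

/-! ### Random polynomials -/

/-- A bound for `∫ |log |z - w|| dμ(w)` that is locally uniform in `z`: the positive part dominates,
since the potential is nonpositive. -/
theorem lintegral_enorm_log_le {μ : Measure ℂ} (hμ : MemPLog μ) {z : ℂ}
    (h : logPotential μ z ≤ 0) :
    ∫⁻ w, ‖Real.log ‖z - w‖‖ₑ ∂μ
      ≤ ENNReal.ofReal (2 * (Real.log 2 + Real.posLog ‖z‖ + ∫ w, Real.posLog ‖w‖ ∂μ)) := by
  have := hμ.1
  obtain ⟨-, hi, h0⟩ := integrable_log_of_logPotential_nonpos hμ.2 h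
  rw [← ofReal_integral_norm_eq_lintegral_enorm hi]
  refine ENNReal.ofReal_le_ofReal ?_
  have hp := integrable_posLog_norm_sub hμ.2 z
  have h1 : ∫ w, ‖Real.log ‖z - w‖‖ ∂μ
      = 2 * ∫ w, Real.posLog ‖z - w‖ ∂μ - logIntegral μ z := by
    rw [logIntegral, ← integral_const_mul, ← integral_sub (hp.const_mul 2) hi]
    exact integral_congr_ae (ae_of_all _ fun w => abs_log_eq _)
  have h2 : ∫ w, Real.posLog ‖z - w‖ ∂μ
      ≤ Real.log 2 + Real.posLog ‖z‖ + ∫ w, Real.posLog ‖w‖ ∂μ := by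
    have h3 := integral_mono hp ((integrable_const (Real.log 2 + Real.posLog ‖z‖)).add hμ.2)
      fun w => posLog_norm_sub_le z w
    rw [integral_add' (integrable_const _) hμ.2] at h3
    simpa using h3
  linarith

/-- The logarithmic average of the first `n` points of a sequence, seen from `z`. -/
noncomputable def empiricalLog (n : ℕ) (x : ℕ → ℂ) (z : ℂ) : ℝ :=
  (n : ℝ)⁻¹ * ∑ i ∈ Finset.range n, Real.log ‖z - x i‖

theorem measurable_empiricalLog (n : ℕ) :
    Measurable fun p : ℂ × (ℕ → ℂ) => empiricalLog n p.2 p.1 := by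
  refine (Finset.measurable_sum _ fun i _ => ?_).const_mul _
  exact measurable_log_norm_sub.comp
    (measurable_fst.prodMk ((measurable_pi_apply i).comp measurable_snd))

/-- The law of large numbers in `L¹`. -/
theorem tendsto_lintegral_empiricalLog {μ : Measure ℂ} [IsProbabilityMeasure μ] {z : ℂ}
    (hi : Integrable (fun w => Real.log ‖z - w‖) μ) :
    Tendsto (fun n => ∫⁻ x, ‖empiricalLog n x z - logIntegral μ z‖ₑ
      ∂(Measure.infinitePi fun _ : ℕ => μ)) atTop (𝓝 0) := by
  have hm := measurable_log_norm_const_sub z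
  have hev := fun i : ℕ => measurePreserving_eval_infinitePi (fun _ : ℕ => μ) i
  have hind := ProbabilityTheory.iIndepFun_infinitePi (P := fun _ : ℕ => μ)
    (X := fun _ w => Real.log ‖z - w‖) (fun _ => hm)
  have hident : ∀ i : ℕ, ProbabilityTheory.IdentDistrib (fun x : ℕ → ℂ => Real.log ‖z - x i‖)
      (fun x : ℕ → ℂ => Real.log ‖z - x 0‖) (Measure.infinitePi fun _ : ℕ => μ)
      (Measure.infinitePi fun _ : ℕ => μ) := by
    intro i
    refine ProbabilityTheory.IdentDistrib.comp (u := fun w => Real.log ‖z - w‖)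
      (f := fun x : ℕ → ℂ => x i) (g := fun x : ℕ → ℂ => x 0) ?_ hm
    exact ⟨(hev i).aemeasurable, (hev 0).aemeasurable, (hev i).map_eq.trans (hev 0).map_eq.symm⟩
  have hL : MemLp (fun x : ℕ → ℂ => Real.log ‖z - x 0‖) 1 (Measure.infinitePi fun _ : ℕ => μ) := by
    rw [memLp_one_iff_integrable]
    exact (hev 0).integrable_comp_of_integrable hi
  have h := ProbabilityTheory.strong_law_Lp le_rfl ENNReal.one_ne_top
    (fun i (x : ℕ → ℂ) => Real.log ‖z - x i‖) hL (fun i j hij => hind.indepFun hij) hident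
  have h0 : ∫ x : ℕ → ℂ, Real.log ‖z - x 0‖ ∂(Measure.infinitePi fun _ : ℕ => μ)
      = logIntegral μ z := by
    rw [logIntegral, ← (hev 0).map_eq, integral_map (hev 0).aemeasurable hm.aestronglyMeasurable]
    simp only [(hev 0).map_eq]
  simpa only [empiricalLog, eLpNorm_one_eq_lintegral_enorm, h0, smul_eq_mul] using h

theorem lintegral_empiricalLog_le {μ : Measure ℂ} [IsProbabilityMeasure μ] (n : ℕ) (z : ℂ) :
    ∫⁻ x, ‖empiricalLog n x z - logIntegral μ z‖ₑ ∂(Measure.infinitePi fun _ : ℕ => μ)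
      ≤ 2 * ∫⁻ w, ‖Real.log ‖z - w‖‖ₑ ∂μ := by
  set I := ∫⁻ w, ‖Real.log ‖z - w‖‖ₑ ∂μ with hI
  have hm : Measurable fun w => ‖Real.log ‖z - w‖‖ₑ := (measurable_log_norm_const_sub z).enorm
  have h1 : ∫⁻ x, ‖empiricalLog n x z‖ₑ ∂(Measure.infinitePi fun _ : ℕ => μ) ≤ I := by
    calc ∫⁻ x, ‖empiricalLog n x z‖ₑ ∂(Measure.infinitePi fun _ : ℕ => μ)
        ≤ ∫⁻ x : ℕ → ℂ, ‖(n : ℝ)⁻¹‖ₑ * ∑ i ∈ Finset.range n, ‖Real.log ‖z - x i‖‖ₑ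
            ∂(Measure.infinitePi fun _ : ℕ => μ) := by
          refine lintegral_mono fun x => ?_
          rw [empiricalLog, enorm_mul]
          gcongr
          exact enorm_sum_le _ _
      _ = ‖(n : ℝ)⁻¹‖ₑ * (n * I) := by
          rw [lintegral_const_mul' _ _ enorm_ne_top,
            lintegral_finsetSum (f := fun i (x : ℕ → ℂ) => ‖Real.log ‖z - x i‖‖ₑ) _
              fun i _ => hm.comp (measurable_pi_apply i)]
          congr 1
          have hi : ∀ i : ℕ, ∫⁻ x : ℕ → ℂ, ‖Real.log ‖z - x i‖‖ₑ
              ∂(Measure.infinitePi fun _ : ℕ => μ) = I := fun i =>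
            (measurePreserving_eval_infinitePi (fun _ : ℕ => μ) i).lintegral_comp hm
          simp only [hi, Finset.sum_const, Finset.card_range, nsmul_eq_mul]
      _ ≤ I := by
          rw [← mul_assoc]
          refine mul_le_of_le_one_left' ?_
          rw [Real.enorm_eq_ofReal (by positivity), ← ENNReal.ofReal_natCast,
            ← ENNReal.ofReal_mul (by positivity), ENNReal.ofReal_le_one]
          exact inv_mul_le_one
  calc _ ≤ ∫⁻ x, (‖empiricalLog n x z‖ₑ + ‖logIntegral μ z‖ₑ)
        ∂(Measure.infinitePi fun _ : ℕ => μ) := lintegral_mono fun x => enorm_sub_le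
    _ = ∫⁻ x, ‖empiricalLog n x z‖ₑ ∂(Measure.infinitePi fun _ : ℕ => μ)
        + ‖logIntegral μ z‖ₑ := by
      rw [lintegral_add_right _ measurable_const]; simp
    _ ≤ I + I := add_le_add h1 (enorm_integral_le_lintegral_enorm _)
    _ = 2 * I := (two_mul I).symm

/-- Some realization of the random points is at least as good as the mean. -/
theorem exists_empiricalLog_near {μ : Measure ℂ} (hμ : MemPLog μ)
    (h : ∀ z, logPotential μ z ≤ 0) (ρ : Measure ℂ) [IsFiniteMeasure ρ] {R : ℝ}
    (hρ : ∀ᵐ z ∂ρ, ‖z‖ ≤ R) {ε : ENNReal} (hε : 0 < ε) :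
    ∃ (n : ℕ) (x : ℕ → ℂ), n ≠ 0 ∧ ∫⁻ z, ‖empiricalLog n x z - logIntegral μ z‖ₑ ∂ρ ≤ ε := by
  have := hμ.1
  set Q := Measure.infinitePi fun _ : ℕ => μ
  have hm : ∀ n, Measurable fun p : ℂ × (ℕ → ℂ) =>
      ‖empiricalLog n p.2 p.1 - logIntegral μ p.1‖ₑ := fun n =>
    ((measurable_empiricalLog n).sub ((measurable_logIntegral μ).comp measurable_fst)).enorm
  have ht : Tendsto (fun n => ∫⁻ z, ∫⁻ x, ‖empiricalLog n x z - logIntegral μ z‖ₑ ∂Q ∂ρ) atTop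
      (𝓝 (∫⁻ _, 0 ∂ρ)) := by
    refine tendsto_lintegral_of_dominated_convergence
      (fun z => 2 * ∫⁻ w, ‖Real.log ‖z - w‖‖ₑ ∂μ) (fun n => (hm n).lintegral_prod_right')
      (fun n => ae_of_all _ fun z => lintegral_empiricalLog_le n z) ?_
      (ae_of_all _ fun z => tendsto_lintegral_empiricalLog
        (integrable_log_of_logPotential_nonpos hμ.2 (h z)).2.1)
    set C : ℝ := 2 * (Real.log 2 + Real.posLog R + ∫ w, Real.posLog ‖w‖ ∂μ)
    have hle : ∫⁻ z, 2 * ∫⁻ w, ‖Real.log ‖z - w‖‖ₑ ∂μ ∂ρ ≤ ∫⁻ _, 2 * ENNReal.ofReal C ∂ρ := by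
      refine lintegral_mono_ae ?_
      filter_upwards [hρ] with z hz
      gcongr
      refine (lintegral_enorm_log_le hμ (h z)).trans (ENNReal.ofReal_le_ofReal ?_)
      have := Real.posLog_le_posLog (norm_nonneg _) hz
      simp only [C]
      linarith
    refine ne_top_of_le_ne_top ?_ hle
    rw [lintegral_const]
    finiteness
  rw [lintegral_zero] at ht
  obtain ⟨n, hn, hn0⟩ := ((ht.eventually_lt_const hε).and (eventually_ge_atTop 1)).exists
  rw [lintegral_lintegral_swap (hm n).aemeasurable] at hn
  obtain ⟨x, hx⟩ := exists_le_lintegral (μ := Q)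
    (f := fun x => ∫⁻ z, ‖empiricalLog n x z - logIntegral μ z‖ₑ ∂ρ)
    (hm n).lintegral_prod_left'.aemeasurable
  exact ⟨n, x, by omega, hx.trans hn.le⟩

/-- A lemniscate whose equilibrium potential is close to that of `μ`. Truncating the empirical
potential at zero only helps, because the potential of `μ` is nonpositive. -/
theorem exists_lemniscateMeasure_near {μ : Measure ℂ} (hμ : MemPLog μ)
    (h : ∀ z, logPotential μ z ≤ 0) (ρ : Measure ℂ) [IsFiniteMeasure ρ] {R : ℝ}
    (hρ : ∀ᵐ z ∂ρ, ‖z‖ ≤ R) (hc : ∀ s : Set ℂ, s.Countable → ∀ᵐ z ∂ρ, z ∉ s)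
    {ε : ENNReal} (hε : 0 < ε) :
    ∃ (P : Polynomial ℂ) (hN : P.natDegree ≠ 0), P.Monic ∧
      ∫⁻ z, ‖logIntegral (lemniscateMeasure P hN) z - logIntegral μ z‖ₑ ∂ρ ≤ ε := by
  obtain ⟨n, x, hn, hx⟩ := exists_empiricalLog_near hμ h ρ hρ hε
  set P : Polynomial ℂ := ∏ i ∈ Finset.range n, (Polynomial.X - Polynomial.C (x i)) with hP
  have hmon : P.Monic := Polynomial.monic_prod_of_monic _ _ fun i _ => Polynomial.monic_X_sub_C _
  have hdeg : P.natDegree = n := by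
    rw [hP, Polynomial.natDegree_prod_of_monic _ _ fun i _ => Polynomial.monic_X_sub_C _]
    simp
  have hN : P.natDegree ≠ 0 := by rw [hdeg]; exact hn
  refine ⟨P, hN, hmon, le_trans (lintegral_mono_ae ?_) hx⟩
  filter_upwards [hc _ (Set.countable_range x)] with z hz
  have hlog : Real.log ‖P.eval z‖ = ∑ i ∈ Finset.range n, Real.log ‖z - x i‖ := by
    rw [hP, Polynomial.eval_prod, norm_prod, Real.log_prod]
    · simp
    · intro i _
      rw [norm_ne_zero_iff]
      simp only [Polynomial.eval_sub, Polynomial.eval_X, Polynomial.eval_C, sub_ne_zero]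
      exact fun e => hz ⟨i, e.symm⟩
  have := hμ.1
  have h0 := (integrable_log_of_logPotential_nonpos hμ.2 (h z)).2.2
  have hmax : logIntegral (lemniscateMeasure P hN) z = max 0 (empiricalLog n x z) := by
    rw [logIntegral_lemniscateMeasure hmon hN, hdeg, empiricalLog, ← hlog, Real.posLog_apply,
      mul_max_of_nonneg _ _ (by positivity), mul_zero]
  rw [hmax, enorm_le_iff_norm_le, Real.norm_eq_abs, Real.norm_eq_abs]
  calc |max 0 (empiricalLog n x z) - logIntegral μ z|
      = |max 0 (empiricalLog n x z) - max 0 (logIntegral μ z)| := by rw [max_eq_right h0]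
    _ ≤ |empiricalLog n x z - logIntegral μ z| := by
      simpa using abs_max_sub_max_le_max 0 (empiricalLog n x z) 0 (logIntegral μ z)

/-! ### The equivalence -/

theorem exists_lemniscates_tendsto {μ : Measure ℂ} (hμ : MemPLog μ)
    (h : ∀ z, logPotential μ z ≤ 0) :
    ∃ (K : ℕ → Set ℂ) (ν : ℕ → Measure ℂ),
      (∀ n, IsCompact (K n) ∧ logCapacity (K n) = 1 ∧ IsEquilibriumMeasure (K n) (ν n)) ∧
        LogWeakTendsto ν μ := by
  set ρ : ℕ → Measure ℂ := fun k =>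
    circleMeasure 0 1 + volume.restrict (Metric.ball (0 : ℂ) k) with hρ
  have hfin : ∀ k, IsFiniteMeasure (volume.restrict (Metric.ball (0 : ℂ) k)) := fun k =>
    ⟨by rw [Measure.restrict_apply_univ]; exact measure_ball_lt_top⟩
  have hex : ∀ k : ℕ, ∃ (P : Polynomial ℂ) (hN : P.natDegree ≠ 0), P.Monic ∧
      ∫⁻ z, ‖logIntegral (lemniscateMeasure P hN) z - logIntegral μ z‖ₑ ∂(ρ k)
        ≤ ((k : ENNReal))⁻¹ := by
    intro k
    have := hfin k
    refine exists_lemniscateMeasure_near hμ h (ρ k) (R := max 1 k) ?_ ?_ (by simp)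
    · refine (ae_add_measure_iff).2 ⟨?_, ?_⟩
      · filter_upwards [ae_circleMeasure_mem_sphere 0 zero_le_one] with z hz
        rw [sub_zero] at hz
        exact hz.le.trans (le_max_left _ _)
      · filter_upwards [ae_restrict_mem measurableSet_ball] with z hz
        exact (mem_ball_zero_iff.1 hz).le.trans (le_max_right _ _)
    · intro s hs
      exact (ae_add_measure_iff).2 ⟨ae_circleMeasure_of_countable hs 0 one_ne_zero,
        ae_restrict_of_ae (hs.ae_notMem _)⟩
  -- for `k = 0` the bound is infinite, which does not affect the limit
  choose P hN hmon hP using hex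
  have hK := fun k => lemniscate_isEquilibriumMeasure (hmon k) (hN k)
  have hω := fun k => memPLog_of_bounded (isCompact_lemniscate (hN k)).isBounded
    (lemniscateMeasure_mem (hN k))
  have hinv : Tendsto (fun k : ℕ => ((k : ENNReal))⁻¹) atTop (𝓝 0) :=
    ENNReal.tendsto_inv_nat_nhds_zero
  refine ⟨_, fun k => lemniscateMeasure (P k) (hN k), hK, logWeakTendsto_of_logIntegral hμ hω
    (fun R => ?_) ?_⟩
  · refine tendsto_of_tendsto_of_tendsto_of_le_of_le' tendsto_const_nhds hinv
      (Eventually.of_forall fun _ => zero_le) ?_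
    filter_upwards [eventually_ge_atTop ⌈R⌉₊] with k hk
    refine (lintegral_mono' ?_ le_rfl).trans (hP k)
    refine (Measure.restrict_mono (Metric.ball_subset_ball ?_) le_rfl).trans
      (Measure.le_add_left le_rfl)
    exact (Nat.le_ceil R).trans (by exact_mod_cast hk)
  · refine tendsto_of_tendsto_of_tendsto_of_le_of_le tendsto_const_nhds hinv
      (fun _ => zero_le) fun k => ?_
    exact (lintegral_mono' (Measure.le_add_right le_rfl) le_rfl).trans (hP k)

theorem theoremD (μ : Measure ℂ) (hμ : MemPLog μ) :
    (∀ z : ℂ, logPotential μ z ≤ 0) ↔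
      ∃ (K : ℕ → Set ℂ) (ν : ℕ → Measure ℂ),
        (∀ n, IsCompact (K n) ∧ logCapacity (K n) = 1 ∧ IsEquilibriumMeasure (K n) (ν n)) ∧
          LogWeakTendsto ν μ :=
  ⟨exists_lemniscates_tendsto hμ, fun ⟨_, _, h, hlim⟩ z =>
    logPotential_nonpos_of_tendsto h hlim z⟩
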